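/- Let $\nu$ be a rotationally invariant Borel probability measure on $\mathbb C$ with $\int_{\mathbb C}\bigl|\log|z|\bigr|\,d\nu(z)<\infty$ (in particular $\nu(\{0\})=0$), and let $V^\nu(z)=\int_{\mathbb C}\log|z-w|\,d\nu(w)$. For $0\le k\le n$ put $$\|z^k\|_{n,\nu}=\Bigl(\int_{\mathbb C}|z|^{2k}e^{-2nV^\nu(z)}\,d\nu(z)\Bigr)^{1/2}.$$ Let $(a_k)_{k\ge 0}$ be i.i.d. complex random variables such that $a_0\ne 0$ almost surely, $a_0$ is not deterministic (not almost surely equal to a constant), and $\mathbb E\log(1+|a_0|)<\infty$. Let $$P_n(z)=\sum_{k=0}^n a_k\,\frac{z^k}{\|z^k\|_{n,\nu}} .$$ For an open set $U\subset\mathbb C$, let $\mathcal C_U$ be the space of locally finite point configurations in $U$ (points counted with multiplicity) with the vague topology, i.e. the smallest topology for which $P\mapsto\sum_{x\in P}f(x)$ is continuous for every continuous compactly supported $f:U\to\mathbb R$. A point process on $U$ is a random element of $\mathcal C_U$ (for the Borel $\sigma$-algebra), and convergence in law of point processes on $U$ is weak convergence of their laws on $\mathcal C_U$. Zeros are always counted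 with multiplicity. Let $R>0$, $D_R=\{|z|<R\}$, $\bar D_R=\{|z|\le R\}$, $\mathbb D=D_1$. 1. (Disk case.) If $D_R$ is a connected component of $\mathbb C\setminus\operatorname{supp}\nu$, then almost surely $\sum_{k\ge0}a_kz^k$ converges for every $z\in\mathbb D$, and, as $n\to\infty$, the point process of the zeros of $P_n$ in $D_R$ converges in law, as point processes on $D_R$, to $$R\cdot\Bigl\{z\in\mathbb D:\ \sum_{k=0}^\infty a_kz^k=0\Bigr\}.$$ 2. (Complement of a disk case.) If $\mathbb C\setminus\bar D_R$ is a connected component of $\mathbb C\setminus\operatorname{supp}\nu$, then almost surely $\sum_{k\ge0}a_kz^{-k}$ converges for every $|z|>1$, and, as $n\to\infty$, the point process of the zeros of $P_n$ in $\mathbb C\setminus\bar D_R$ converges in law, as point processes on $\mathbb C\setminus\bar D_R$, to $$R\cdot\Bigl\{z\in\mathbb C\setminus\bar{\mathbb D}:\ \sum_{k=0}^\infty a_kz^{-k}=0\Bigr\}.$$ -/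

import Mathlib

open MeasureTheory ProbabilityTheory Filter Topology
open scoped CompactlySupported

/-! ### Point configurations and point processes -/

/-- A point configuration on `X`: a locally finite family of points of `X`, counted with
multiplicity (equivalently, a locally finite measure taking values in `ℕ ∪ {∞}`). -/
@[ext]
structure PointConfig (X : Type*) [TopologicalSpace X] where
  /-- the multiplicity of each point (zero if the point does not belong to the configuration) -/
  mult : X → ℕ
  locallyFinite : LocallyFiniteSupport mult

namespace PointConfig

variable {X Y : Type*} [TopologicalSpace X] [TopologicalSpace Y]

/-- The sum of the values of `f` over the points of a configuration, with multiplicity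
(a finite sum when `f` has compact support). -/
noncomputable def linStat (f : X → ℝ) (P : PointConfig X) : ℝ :=
  ∑ᶠ x : X, (P.mult x : ℝ) * f x

/-- The vague topology: the smallest topology such that `P ↦ ∑_{x ∈ P} f x` is continuous for
every continuous `f : X → ℝ` with compact support. -/
noncomputable instance : TopologicalSpace (PointConfig X) :=
  ⨅ f : C_c(X, ℝ), TopologicalSpace.induced (linStat f) inferInstance

noncomputable instance : MeasurableSpace (PointConfig X) := borel _

instance : BorelSpace (PointConfig X) := ⟨rfl⟩

/-- The image of a point configuration under a homeomorphism. -/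
def map (e : X ≃ₜ Y) (P : PointConfig X) : PointConfig Y where
  mult y := P.mult (e.symm y)
  locallyFinite y := by
    obtain ⟨t, ht, hfin⟩ := P.locallyFinite (e.symm y)
    refine ⟨e.symm ⁻¹' t, e.symm.continuous.continuousAt ht, ?_⟩
    have h : e.symm ⁻¹' t ∩ Function.support (fun y => P.mult (e.symm y))
        = e.symm ⁻¹' (t ∩ Function.support P.mult) := rfl
    rw [h]
    exact hfin.preimage e.symm.injective.injOn

end PointConfig

lemma locallyFiniteSupport_analyticOrder {U : Set ℂ} {f : ℂ → ℂ} (hf : AnalyticOnNhd ℂ f U) :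
    LocallyFiniteSupport (fun x : U => analyticOrderNatAt f x) := by
  intro x
  suffices h : ∃ s ∈ 𝓝 (x : ℂ), ∀ y ∈ s, analyticOrderNatAt f y ≠ 0 → y = (x : ℂ) by
    obtain ⟨s, hs, h⟩ := h
    refine ⟨Subtype.val ⁻¹' s, continuous_subtype_val.continuousAt hs,
      (Set.finite_singleton x).subset ?_⟩
    rintro y ⟨hy, hy'⟩
    exact Subtype.ext (h y hy hy')
  rcases (hf x x.2).eventually_eq_zero_or_eventually_ne_zero with h | h
  · refine ⟨_, eventually_eventually_nhds.2 h, fun y hy hne => (hne ?_).elim⟩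
    rw [analyticOrderNatAt, analyticOrderAt_eq_top.2 hy]
    rfl
  · rw [eventually_nhdsWithin_iff] at h
    refine ⟨_, h, fun y hy hne => ?_⟩
    by_contra hxy
    exact hy hxy (apply_eq_zero_of_analyticOrderNatAt_ne_zero hne)

open Classical in
/-- The zeros in `U` of a function `f` that is holomorphic on `U` and not identically zero near
any point of `U`, each counted with its multiplicity, as a point configuration on `U`.
(If `f` is not holomorphic on `U`, the value is the empty configuration.) -/
noncomputable def zerosIn (U : Set ℂ) (f : ℂ → ℂ) : PointConfig U :=
  if hf : AnalyticOnNhd ℂ f U then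
    { mult := fun x => analyticOrderNatAt f x
      locallyFinite := locallyFiniteSupport_analyticOrder hf }
  else
    { mult := fun _ => 0
      locallyFinite := fun _ => ⟨Set.univ, univ_mem, by simp⟩ }

/-! ### Disks, their complements, and dilations -/

/-- The open disk of radius `R` centred at `0`. -/
def disk (R : ℝ) : Set ℂ := {z | ‖z‖ < R}

/-- The complement of the closed disk of radius `R` centred at `0`. -/
def exteriorDisk (R : ℝ) : Set ℂ := {z | R < ‖z‖}

/-- The dilation `z ↦ R z` as a homeomorphism from the unit disk to the disk of radius `R`. -/
noncomputable def diskDilation {R : ℝ} (hR : 0 < R) : disk 1 ≃ₜ disk R :=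
  (Homeomorph.mulLeft₀ (R : ℂ) (Complex.ofReal_ne_zero.2 hR.ne')).subtype fun z => by
    simp [disk, abs_of_pos hR, hR]

/-- The dilation `z ↦ R z` as a homeomorphism from the complement of the closed unit disk to the
complement of the closed disk of radius `R`. -/
noncomputable def exteriorDilation {R : ℝ} (hR : 0 < R) : exteriorDisk 1 ≃ₜ exteriorDisk R :=
  (Homeomorph.mulLeft₀ (R : ℂ) (Complex.ofReal_ne_zero.2 hR.ne')).subtype fun z => by
    simp [exteriorDisk, abs_of_pos hR, hR]

/-- `U` is a connected component of the set `S`. -/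
def IsComponentOf (U S : Set ℂ) : Prop := ∃ x ∈ S, connectedComponentIn S x = U

/-! ### The background measure -/

/-- `ν` is invariant under rotations about the origin and `∫ |log |z|| dν(z) < ∞`. As
`Real.log 0 = 0`, the fact that `0` is not an atom (where `log |z| = -∞`) is a separate field. -/
structure IsBackground (ν : Measure ℂ) : Prop where
  rotationInvariant : ∀ c : ℂ, ‖c‖ = 1 → ν.map (fun z => c * z) = ν
  zero_not_atom : ν {0} = 0
  integrable_log : Integrable (fun z : ℂ => Real.log ‖z‖) ν

/-- The logarithmic potential `V^ν(z) = ∫ log |z - w| dν(w)`. -/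
noncomputable def logPotential (ν : Measure ℂ) (z : ℂ) : ℝ :=
  ∫ w, Real.log ‖z - w‖ ∂ν

/-- The norm of the monomial `z ^ k` for the inner product
`⟨P, Q⟩_{n,ν} = ∫ P(z) conj(Q(z)) exp(-2 n V^ν(z)) dν(z)`. -/
noncomputable def monomialNorm (ν : Measure ℂ) (n k : ℕ) : ℝ :=
  Real.sqrt (∫ z, ‖z ^ k‖ ^ 2 * Real.exp (-2 * n * logPotential ν z) ∂ν)

/-! ### Random coefficients, polynomials and series -/

/-- `(a_k)` are i.i.d. complex random variables, almost surely nonzero, not almost surely equal to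
a constant, and such that `E log (1 + |a_0|) < ∞`. -/
structure IsCoefficientSequence {Ω : Type*} [MeasurableSpace Ω] (μ : Measure Ω)
    (a : ℕ → Ω → ℂ) : Prop where
  measurable : ∀ k, Measurable (a k)
  indep : iIndepFun a μ
  identDistrib : ∀ k, IdentDistrib (a k) (a 0) μ μ
  ae_ne_zero : ∀ᵐ ω ∂μ, a 0 ω ≠ 0
  not_deterministic : ¬ ∃ c : ℂ, ∀ᵐ ω ∂μ, a 0 ω = c
  integrable_log : Integrable (fun ω => Real.log (1 + ‖a 0 ω‖)) μ

/-- The polynomial `P_n(z) = ∑_{k=0}^n a_k z^k / ‖z^k‖_{n,ν}` with coefficients `a`. -/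
noncomputable def weightedPoly (ν : Measure ℂ) (n : ℕ) (a : ℕ → ℂ) (z : ℂ) : ℂ :=
  ∑ k ∈ Finset.range (n + 1), a k * (z ^ k / (monomialNorm ν n k : ℂ))

/-- The power series `∑_{k ≥ 0} a_k z^k`. -/
noncomputable def coeffSeries (a : ℕ → ℂ) (z : ℂ) : ℂ := ∑' k : ℕ, a k * z ^ k

/-! Averaging $\log|z-w|$ over rotations turns the potential into
$V^\nu(z)=\int\max(\log|z|,\log|w|)\,d\nu(w)$ for $z\ne0$ (`logPotential_eq_integral_posLog`). In
the disk case put $s=\log(|z|/R)$. Since the disk is a component of the complement of the support,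
$s\ge0$ almost everywhere and its essential infimum is $0$. Up to an additive constant $V^\nu$ is
the mean excess $\int(s(z)-s(w))^+d\nu(w)$, so $\|z^k\|_{n,\nu}^2$ is $R^{2k}$ times a factor free
of $k$ times $\int e^{2ks-2n\cdot\text{excess}}d\nu$.

As $n\to\infty$ the weight concentrates where $s$ is near $0$, so for fixed $k$ this integral is
asymptotic to the one with $k=0$ (`tendsto_penalizedMoment_div`). Hence $P_n(z)$ is a nonzero
constant times $\sum_{k\le n}a_kb_{n,k}(z/R)^k$ with $0<b_{n,k}\le1$ and $b_{n,k}\to1$. The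
logarithmic moment makes $\sum a_kw^k$ converge in the unit disk almost surely, so these sums
converge locally uniformly there. Hurwitz's theorem (`tendsto_zerosIn`) then gives almost sure vague
convergence of the zeros, hence convergence in law.

The exterior case is the same with $s=\log(R/|z|)$ and the variable $R/z$, after reversing the
coefficients $a_0,\dots,a_n$. Reversal preserves their joint law for each $n$ (`map_reverseUpTo`),
which suffices for convergence in law. -/

namespace PointConfig

/-! ### Linear statistics and the vague topology. -/

section LinStat

variable {X : Type*} [TopologicalSpace X]

lemma finite_support_mult_mul (P : PointConfig X) {f : X → ℝ} (hf : HasCompactSupport f) :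
    (Function.support fun x => (P.mult x : ℝ) * f x).Finite := by
  refine (P.locallyFinite.finite_inter_support_of_isCompact hf).subset fun x hx => ?_
  have h := mul_ne_zero_iff.1 hx
  exact ⟨subset_tsupport f h.2, by simpa using h.1⟩

lemma linStat_sub (P : PointConfig X) {f g : X → ℝ} (hf : HasCompactSupport f)
    (hg : HasCompactSupport g) : linStat (fun x => f x - g x) P = linStat f P - linStat g P := by
  simp only [linStat, mul_sub]
  exact finsum_sub_distrib (P.finite_support_mult_mul hf) (P.finite_support_mult_mul hg)

lemma linStat_sum (P : PointConfig X) {ι : Type*} (s : Finset ι) {f : ι → X → ℝ}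
    (hf : ∀ i ∈ s, HasCompactSupport (f i)) :
    linStat (fun x => ∑ i ∈ s, f i x) P = ∑ i ∈ s, linStat (f i) P := by
  simp only [linStat, Finset.mul_sum]
  exact finsum_sum_comm s _ fun i hi => P.finite_support_mult_mul (hf i hi)

lemma linStat_const_mul (P : PointConfig X) (c : ℝ) (f : X → ℝ) :
    linStat (fun x => c * f x) P = c * linStat f P := by
  rw [linStat, linStat, ← smul_eq_mul c, smul_finsum]
  exact finsum_congr fun x => by simp only [smul_eq_mul]; ring

lemma linStat_mono (P : PointConfig X) {f g : X → ℝ} (hf : HasCompactSupport f)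
    (hg : HasCompactSupport g) (h : ∀ x, f x ≤ g x) : linStat f P ≤ linStat g P :=
  finsum_le_finsum' (P.finite_support_mult_mul hf) (P.finite_support_mult_mul hg)
    fun x => mul_le_mul_of_nonneg_left (h x) (Nat.cast_nonneg _)

/-- Uniform closeness of test functions controls linear statistics only through the number of points
involved; a cutoff `h` measures that number. -/
lemma abs_linStat_sub_le (P : PointConfig X) {f g h : X → ℝ} (hf : HasCompactSupport f)
    (hg : HasCompactSupport g) (hh : HasCompactSupport h) {ε : ℝ}
    (hle : ∀ x, |f x - g x| ≤ ε * h x) :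
    |linStat f P - linStat g P| ≤ ε * linStat h P := by
  have hεh : HasCompactSupport fun x => ε * h x := hh.mul_left
  have hfg : HasCompactSupport fun x => f x - g x := hf.sub hg
  rw [← linStat_sub P hf hg, ← linStat_const_mul, abs_le]
  constructor
  · have := linStat_mono P (f := fun x => (-1) * (ε * h x)) hεh.mul_left hfg
      fun x => by linarith [(abs_le.1 (hle x)).1]
    rw [linStat_const_mul] at this
    linarith
  · exact linStat_mono P hfg hεh fun x => (abs_le.1 (hle x)).2

lemma continuous_linStat (f : C_c(X, ℝ)) : Continuous (linStat f : PointConfig X → ℝ) :=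
  continuous_iff_le_induced.2 (iInf_le _ f)

lemma nhds_eq_iInf_comap (P : PointConfig X) :
    𝓝 P = ⨅ f : C_c(X, ℝ), comap (linStat f) (𝓝 (linStat f P)) := by
  rw [nhds_iInf]
  exact iInf_congr fun f => nhds_induced _ _

lemma tendsto_iff {α : Type*} {l : Filter α} {Q : α → PointConfig X} {P : PointConfig X} :
    Tendsto Q l (𝓝 P) ↔
      ∀ f : C_c(X, ℝ), Tendsto (fun i => linStat f (Q i)) l (𝓝 (linStat f P)) := by
  simp only [nhds_eq_iInf_comap, tendsto_iInf, tendsto_comap_iff, Function.comp_def]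

end LinStat

/-! ### Pseudometrizability of the vague topology. -/

section Countable

variable {X : Type*} [TopologicalSpace X] [T2Space X] [LocallyCompactSpace X]
  [SecondCountableTopology X]

/-- Countably many test functions approximate every test function supported in a given compact
set, uniformly with respect to a test function which is also in the family. -/
lemma exists_seq_approx {K : Set X} (hK : IsCompact K) :
    ∃ d : ℕ → C_c(X, ℝ), ∃ χ : C_c(X, ℝ), ∀ f : X → ℝ, Continuous f → (∀ x ∉ K, f x = 0) →
      ∀ ε > 0, ∃ k, ∀ x, |f x - d k x| ≤ ε * χ x := by
  obtain ⟨χ, hχ1, -, hχc, hχ⟩ := exists_continuous_one_zero_of_isCompact hK isClosed_empty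
    (Set.disjoint_empty K)
  -- The compact-open topology on `C(X, ℝ)` is second countable, so `A` has a dense sequence, and
  -- closeness in it is uniform on `K`.
  let A : Set C(X, ℝ) := {f | ∀ x ∉ K, f x = 0}
  have : Nonempty A := ⟨⟨0, fun x _ => rfl⟩⟩
  have hsupp (f : C(X, ℝ)) (hf : f ∈ A) : HasCompactSupport f :=
    HasCompactSupport.intro hK hf
  refine ⟨fun k => ⟨TopologicalSpace.denseSeq A k, hsupp _ (TopologicalSpace.denseSeq A k).2⟩,
    ⟨χ, hχc⟩, fun f hf hfK ε hε => ?_⟩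
  have hfA : (⟨f, hf⟩ : C(X, ℝ)) ∈ A := hfK
  have hnhds : ∀ᶠ g in 𝓝 (⟨f, hf⟩ : C(X, ℝ)), ∀ x ∈ K, dist (f x) (g x) < ε :=
    Metric.tendstoUniformlyOn_iff.1
      (ContinuousMap.tendsto_iff_forall_isCompact_tendstoUniformlyOn.1 tendsto_id K hK) ε hε
  have hnhds' : ∀ᶠ g : A in 𝓝 (⟨⟨f, hf⟩, hfA⟩ : A), ∀ x ∈ K, dist (f x) (g.1 x) < ε :=
    (continuous_subtype_val.tendsto (⟨⟨f, hf⟩, hfA⟩ : A)).eventually hnhds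
  obtain ⟨_, ⟨k, rfl⟩, hg⟩ :=
    (TopologicalSpace.denseRange_denseSeq A).inter_nhds_nonempty hnhds'
  refine ⟨k, fun x => ?_⟩
  change |f x - (TopologicalSpace.denseSeq A k).1 x| ≤ ε * χ x
  by_cases hx : x ∈ K
  · rw [hχ1 hx, Pi.one_apply, mul_one]
    exact (hg x hx).le
  · rw [hfK x hx, (TopologicalSpace.denseSeq A k).2 x hx, sub_zero, abs_zero]
    exact mul_nonneg hε.le (hχ x).1

/-- The vague topology is induced by countably many linear statistics. -/
lemma exists_isInducing_linStat :
    ∃ d : ℕ × Option ℕ → C_c(X, ℝ),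
      IsInducing (fun (P : PointConfig X) (i : ℕ × Option ℕ) => linStat (d i) P) := by
  let K := CompactExhaustion.choice X
  choose d χ hd using fun m => exists_seq_approx (K.isCompact m)
  -- The index `none` stands for the cutoff, `some k` for the `k`-th approximating function.
  let D : ℕ × Option ℕ → C_c(X, ℝ) := fun i => i.2.elim (χ i.1) (d i.1)
  refine ⟨D, isInducing_iff_nhds.2 fun P => le_antisymm ?_ ?_⟩
  · rw [← tendsto_iff_comap]
    exact (continuous_pi fun i => continuous_linStat _).tendsto P
  rw [nhds_eq_iInf_comap, le_iInf_iff]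
  intro f
  rw [← tendsto_iff_comap, Metric.tendsto_nhds]
  intro ε hε
  obtain ⟨m, hm⟩ := K.exists_superset_of_isCompact f.hasCompactSupport
  set l := comap (fun (P : PointConfig X) (i : ℕ × Option ℕ) => linStat (D i) P)
    (𝓝 fun i => linStat (D i) P)
  have hl (i : ℕ × Option ℕ) : Tendsto (linStat (D i)) l (𝓝 (linStat (D i) P)) :=
    tendsto_pi_nhds.1 (tendsto_comap (f := fun (P : PointConfig X) i => linStat (D i) P)) i
  have hC : ∀ᶠ Q in l,
      linStat (χ m) Q < |linStat (χ m) P| + 1 :=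
    (hl (m, none)).eventually_lt_const
      (by change linStat (χ m) P < _; linarith [le_abs_self (linStat (χ m) P)])
  set C := |linStat (χ m) P| + 1 with hCdef
  have hCpos : 0 < C := by positivity
  -- The cutoff statistic is at most `C` at `P` and nearby, so precision `ε / (4 * C)` costs `ε / 4`
  -- at each of `P` and `Q`; the statistic of `d m k` costs another `ε / 4`.
  obtain ⟨k, hk⟩ := hd m f f.continuous
    (fun x hx => image_eq_zero_of_notMem_tsupport fun h => hx (hm h)) (ε / (4 * C)) (by positivity)
  have hk' : ∀ᶠ Q in l,
      dist (linStat (d m k) Q) (linStat (d m k) P) < ε / 4 :=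
    Metric.tendsto_nhds.1 (hl (m, some k)) _ (by positivity)
  have key (Q : PointConfig X) (hQ : linStat (χ m) Q ≤ C) :
      |linStat f Q - linStat (d m k) Q| ≤ ε / 4 := by
    refine (abs_linStat_sub_le Q f.hasCompactSupport (d m k).hasCompactSupport
      (χ m).hasCompactSupport hk).trans ?_
    calc ε / (4 * C) * linStat (χ m) Q ≤ ε / (4 * C) * C := by gcongr
      _ = ε / 4 := by field_simp
  filter_upwards [hC, hk'] with Q hQ hQ'
  have h1 := abs_le.1 (key Q hQ.le)
  have h2 := abs_le.1 (key P (by linarith [le_abs_self (linStat (χ m) P)]))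
  rw [Real.dist_eq, abs_lt] at hQ' ⊢
  constructor <;> linarith [h1.1, h1.2, h2.1, h2.2, hQ'.1, hQ'.2]

/-- Ensures that an almost sure limit of measurable random configurations is almost everywhere
measurable. -/
instance : TopologicalSpace.PseudoMetrizableSpace (PointConfig X) :=
  (exists_isInducing_linStat (X := X)).choose_spec.pseudoMetrizableSpace

end Countable

end PointConfig

/-! ### Hurwitz's theorem by way of Jensen's formula. -/

open MeromorphicOn in
/-- The difference of the circle averages of `log ‖f‖` over two concentric circles counts the zeros
of `f`, if there are none between the circles. -/
lemma exists_finset_zeros_circleAverage_sub {f : ℂ → ℂ} {c : ℂ} {r₁ r₂ : ℝ} (h₁ : 0 < r₁)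
    (h₁₂ : r₁ < r₂) (hf : AnalyticOnNhd ℂ f (Metric.closedBall c r₂))
    (hne : ∀ z, r₁ ≤ dist z c → dist z c ≤ r₂ → f z ≠ 0) :
    ∃ S : Finset ℂ, (∀ u ∈ S, dist u c < r₁) ∧
      (∀ u ∈ Metric.closedBall c r₂, f u = 0 → u ∈ S) ∧
      Real.circleAverage (fun z => Real.log ‖f z‖) c r₂
        - Real.circleAverage (fun z => Real.log ‖f z‖) c r₁
        = (∑ u ∈ S, analyticOrderNatAt f u : ℕ) * (Real.log r₂ - Real.log r₁) := by
  have h₂ : 0 < r₂ := h₁.trans h₁₂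
  have hdiv {r : ℝ} (hr : r ≤ r₂) {u : ℂ} (hu : u ∈ Metric.closedBall c r) :
      divisor f (Metric.closedBall c r) u = (analyticOrderNatAt f u : ℤ) := by
    rw [(hf.mono (Metric.closedBall_subset_closedBall hr)).divisor_apply hu, analyticOrderNatAt]
    cases analyticOrderAt f u <;> simp
  have hfin := (divisor f (Metric.closedBall c r₂)).finiteSupport (isCompact_closedBall c r₂)
  have hS (u : ℂ) : u ∈ hfin.toFinset ↔ u ∈ Metric.closedBall c r₂ ∧ analyticOrderNatAt f u ≠ 0 := by
    rw [Set.Finite.mem_toFinset, Function.mem_support]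
    by_cases hu : u ∈ Metric.closedBall c r₂
    · rw [hdiv le_rfl hu]
      simp [hu]
    · simp [Function.locallyFinsuppWithin.apply_eq_zero_of_notMem _ hu, hu]
  have hS₁ (u : ℂ) (hu : u ∈ hfin.toFinset) : dist u c < r₁ := by
    by_contra! h
    exact hne u h ((hS u).1 hu).1 (apply_eq_zero_of_analyticOrderNatAt_ne_zero ((hS u).1 hu).2)
  obtain ⟨p, hp⟩ : ∃ p : ℂ, dist p c = r₂ :=
    ⟨c + r₂, by simp [abs_of_pos h₂]⟩
  have htop (u : ℂ) (hu : u ∈ Metric.closedBall c r₂) : analyticOrderAt f u ≠ ⊤ := by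
    refine hf.analyticOrderAt_ne_top_of_isPreconnected
      (convex_closedBall c r₂).isPreconnected (x := p) (by simp [hp]) hu ?_
    rw [(hf p (by simp [hp])).analyticOrderAt_eq_zero.2 (hne p (by linarith) hp.le)]
    exact ENat.zero_ne_top
  -- A zero at the centre is included in the sum: there `Real.log 0 = 0` leaves the correct term
  -- `order * log r`. The trailing coefficient does not depend on `r` and cancels in the difference.
  have jensen {r : ℝ} (hr₁ : r₁ ≤ r) (hr₂ : r ≤ r₂) :
      Real.circleAverage (fun z => Real.log ‖f z‖) c r
        = ∑ u ∈ hfin.toFinset, (analyticOrderNatAt f u : ℝ) * (Real.log r - Real.log ‖c - u‖)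
          + Real.log ‖meromorphicTrailingCoeffAt f c‖ := by
    have hr : 0 < r := h₁.trans_le hr₁
    have habs : |r| = r := abs_of_pos hr
    have hfr : (divisor f (Metric.closedBall c r)).support.Finite :=
      (divisor f (Metric.closedBall c r)).finiteSupport (isCompact_closedBall c r)
    rw [MeromorphicOn.circleAverage_log_norm hr.ne' (by
      rw [habs]; exact (hf.mono (Metric.closedBall_subset_closedBall hr₂)).meromorphicOn), habs,
      ← countingFunction_finsum_eq_finsum_add hr.ne' hfr]
    congr 1
    rw [finsum_eq_sum_of_support_subset (s := hfin.toFinset)]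
    · refine Finset.sum_congr rfl fun u hu => ?_
      rw [hdiv hr₂ (Metric.mem_closedBall.2 ((hS₁ u hu).le.trans hr₁)), Int.cast_natCast]
    · intro u hu
      have hu' : divisor f (Metric.closedBall c r) u ≠ 0 := by
        simpa using left_ne_zero_of_mul hu
      have hmem : u ∈ Metric.closedBall c r := by
        by_contra h
        exact hu' (Function.locallyFinsuppWithin.apply_eq_zero_of_notMem _ h)
      rw [hdiv hr₂ hmem] at hu'
      exact (hS u).2 ⟨Metric.closedBall_subset_closedBall hr₂ hmem, by exact_mod_cast hu'⟩
  refine ⟨hfin.toFinset, hS₁, fun u hu hu0 => (hS u).2 ⟨hu, fun h => ?_⟩, ?_⟩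
  · rw [analyticOrderNatAt, ENat.toNat_eq_zero] at h
    exact h.elim (fun h => (hf u hu).analyticOrderAt_eq_zero.1 h hu0) (htop u hu)
  · rw [jensen h₁₂.le le_rfl, jensen le_rfl h₁₂.le, add_sub_add_right_eq_sub,
      ← Finset.sum_sub_distrib, Nat.cast_sum, Finset.sum_mul]
    exact Finset.sum_congr rfl fun u _ => by ring

lemma abs_log_sub_log_le {x y m : ℝ} (hm : 0 < m) (hx : m ≤ x) (hy : m ≤ y) :
    |Real.log x - Real.log y| ≤ |x - y| / m := by
  have key {s t : ℝ} (hs : m ≤ s) (ht : m ≤ t) : Real.log s - Real.log t ≤ |s - t| / m := by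
    have hs' := hm.trans_le hs
    have ht' := hm.trans_le ht
    rw [← Real.log_div hs'.ne' ht'.ne']
    calc Real.log (s / t) ≤ s / t - 1 := Real.log_le_sub_one_of_pos (by positivity)
      _ = (s - t) / t := by field_simp
      _ ≤ |s - t| / t := by gcongr; exact le_abs_self _
      _ ≤ |s - t| / m := by gcongr
  refine abs_le.2 ⟨?_, key hx hy⟩
  have := key hy hx
  rw [abs_sub_comm] at this
  linarith

/-- The logarithm is `1 / m`-Lipschitz on `[m, ∞)`; this makes the zero count in Jensen's formula
stable under uniform perturbation. -/
lemma abs_circleAverage_log_norm_sub_le {f g : ℂ → ℂ} {c : ℂ} {r m δ : ℝ} (hr : 0 < r) (hm : 0 < m)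
    (hf : AnalyticOnNhd ℂ f (Metric.sphere c r)) (hg : AnalyticOnNhd ℂ g (Metric.sphere c r))
    (hfm : ∀ z ∈ Metric.sphere c r, m ≤ ‖f z‖) (hgm : ∀ z ∈ Metric.sphere c r, m ≤ ‖g z‖)
    (hfg : ∀ z ∈ Metric.sphere c r, ‖f z - g z‖ ≤ δ) :
    |Real.circleAverage (fun z => Real.log ‖f z‖) c r
      - Real.circleAverage (fun z => Real.log ‖g z‖) c r| ≤ δ / m := by
  have habs : |r| = r := abs_of_pos hr
  have hfi : CircleIntegrable (fun z => Real.log ‖f z‖) c r :=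
    MeromorphicOn.circleIntegrable_log_norm (by rw [habs]; exact hf.meromorphicOn)
  have hgi : CircleIntegrable (fun z => Real.log ‖g z‖) c r :=
    MeromorphicOn.circleIntegrable_log_norm (by rw [habs]; exact hg.meromorphicOn)
  rw [← Real.circleAverage_sub hfi hgi]
  refine Real.abs_circleAverage_le_circleAverage_abs.trans ?_
  refine Real.circleAverage_mono_on_of_le_circle (hfi.sub hgi).abs fun z hz => ?_
  rw [habs] at hz
  refine (abs_log_sub_log_le hm (hfm z hz) (hgm z hz)).trans ?_
  gcongr
  exact (abs_norm_sub_norm_le _ _).trans (hfg z hz)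

/-- **Hurwitz's theorem** in a closed disk with an isolated zero of the limit at its centre. -/
lemma eventually_exists_finset_zeros {ι : Type*} {l : Filter ι} {F : ι → ℂ → ℂ} {f : ℂ → ℂ} {c : ℂ}
    {r₁ r₂ : ℝ} (h₁ : 0 < r₁) (h₁₂ : r₁ < r₂)
    (hF : ∀ᶠ i in l, AnalyticOnNhd ℂ (F i) (Metric.closedBall c r₂))
    (hf : AnalyticOnNhd ℂ f (Metric.closedBall c r₂))
    (hne : ∀ z ∈ Metric.closedBall c r₂, z ≠ c → f z ≠ 0)
    (hlim : TendstoUniformlyOn F f l (Metric.closedBall c r₂)) :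
    ∀ᶠ i in l, ∃ S : Finset ℂ, (∀ u ∈ S, dist u c < r₁) ∧
      (∀ u ∈ Metric.closedBall c r₂, F i u = 0 → u ∈ S) ∧
      ∑ u ∈ S, analyticOrderNatAt (F i) u = analyticOrderNatAt f c := by
  have h₂ : 0 < r₂ := h₁.trans h₁₂
  have hfne (z : ℂ) (hz₁ : r₁ ≤ dist z c) (hz₂ : dist z c ≤ r₂) : f z ≠ 0 :=
    hne z hz₂ (dist_pos.1 (h₁.trans_le hz₁))
  have hcomp : IsCompact (Metric.closedBall c r₂ ∩ {z | r₁ ≤ dist z c}) :=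
    (isCompact_closedBall c r₂).inter_right
      (isClosed_le continuous_const (continuous_id.dist continuous_const))
  obtain ⟨m, hm, hmle⟩ : ∃ m > 0, ∀ z ∈ Metric.closedBall c r₂ ∩ {z | r₁ ≤ dist z c}, m ≤ ‖f z‖ :=
    hcomp.exists_forall_le' (hf.continuousOn.norm.mono Set.inter_subset_left)
      fun z hz => norm_pos_iff.2 (hfne z hz.2 hz.1)
  have hL : 0 < Real.log r₂ - Real.log r₁ := sub_pos.2 (Real.log_lt_log h₁ h₁₂)
  set L := Real.log r₂ - Real.log r₁ with hLdef
  obtain ⟨Sf, hSf₁, hSf, hcount⟩ := exists_finset_zeros_circleAverage_sub h₁ h₁₂ hf hfne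
  have hsum : ∑ u ∈ Sf, analyticOrderNatAt f u = analyticOrderNatAt f c := by
    refine Finset.sum_eq_single c (fun u hu huc => ?_) fun hc => ?_
    · by_contra h
      exact hne u (Metric.mem_closedBall.2 ((hSf₁ u hu).le.trans h₁₂.le)) huc
        (apply_eq_zero_of_analyticOrderNatAt_ne_zero h)
    · by_contra h
      exact hc (hSf c (by simp [h₂.le]) (apply_eq_zero_of_analyticOrderNatAt_ne_zero h))
  -- Closeness `m / 2` keeps `‖F i‖ ≥ m / 2` on the annulus. Closeness `m * L / 8`, divided by `m /
  -- 2`, moves each circle average by at most `L / 4`, so the two integer counts differ by at most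
  -- `1 / 2` and are equal.
  filter_upwards [hF, Metric.tendstoUniformlyOn_iff.1 hlim (min (m / 2) (m * L / 8))
    (by positivity)] with i hFi hi
  have hclose (z : ℂ) (hz : z ∈ Metric.closedBall c r₂) :
      ‖F i z - f z‖ ≤ min (m / 2) (m * L / 8) := by
    rw [← dist_eq_norm, dist_comm]
    exact (hi z hz).le
  have hlow (z : ℂ) (hz₁ : r₁ ≤ dist z c) (hz₂ : dist z c ≤ r₂) : m / 2 ≤ ‖F i z‖ := by
    have := hmle z ⟨hz₂, hz₁⟩
    have h3 := (hclose z hz₂).trans (min_le_left _ _)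
    have h4 := norm_sub_norm_le (f z) (F i z)
    rw [norm_sub_rev] at h4
    linarith
  have hFne (z : ℂ) (hz₁ : r₁ ≤ dist z c) (hz₂ : dist z c ≤ r₂) : F i z ≠ 0 :=
    norm_pos_iff.1 ((half_pos hm).trans_le (hlow z hz₁ hz₂))
  obtain ⟨S, hS₁, hS₂, hS⟩ := exists_finset_zeros_circleAverage_sub h₁ h₁₂ hFi hFne
  refine ⟨S, hS₁, hS₂, hsum ▸ ?_⟩
  have havg {r : ℝ} (hr₁ : r₁ ≤ r) (hr₂ : r ≤ r₂) :
      |Real.circleAverage (fun z => Real.log ‖F i z‖) c r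
        - Real.circleAverage (fun z => Real.log ‖f z‖) c r| ≤ L / 4 := by
    have hsub : Metric.sphere c r ⊆ Metric.closedBall c r₂ :=
      Metric.sphere_subset_closedBall.trans (Metric.closedBall_subset_closedBall hr₂)
    refine (abs_circleAverage_log_norm_sub_le (h₁.trans_le hr₁) (half_pos hm) (hFi.mono hsub)
      (hf.mono hsub) (δ := m * L / 8) ?_ ?_ ?_).trans (le_of_eq (by field_simp; norm_num))
    · intro z hz
      rw [mem_sphere_iff_norm, ← dist_eq_norm] at hz
      exact hlow z (hz ▸ hr₁) (hz ▸ hr₂)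
    · intro z hz
      have hz' := hsub hz
      rw [mem_sphere_iff_norm, ← dist_eq_norm] at hz
      linarith [hmle z ⟨hz', hr₁.trans_eq hz.symm⟩]
    · exact fun z hz => (hclose z (hsub hz)).trans (min_le_right _ _)
  have ha := abs_le.1 (havg h₁₂.le le_rfl)
  have hb := abs_le.1 (havg le_rfl h₁₂.le)
  have hlt : |((∑ u ∈ S, analyticOrderNatAt (F i) u : ℕ) : ℝ)
      - (∑ u ∈ Sf, analyticOrderNatAt f u : ℕ)| * L < 1 * L := by
    rw [← abs_of_pos hL, ← abs_mul, abs_of_pos hL, sub_mul, ← hS, ← hcount, abs_lt]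
    constructor <;> linarith [ha.1, ha.2, hb.1, hb.2]
  have hlt' := lt_of_mul_lt_mul_right hlt hL.le
  have : |((∑ u ∈ S, analyticOrderNatAt (F i) u : ℕ) : ℤ)
      - (∑ u ∈ Sf, analyticOrderNatAt f u : ℕ)| < 1 := by exact_mod_cast hlt'
  have := Int.abs_lt_one_iff.1 this
  omega

lemma zerosIn_mult {U : Set ℂ} {f : ℂ → ℂ} (hf : AnalyticOnNhd ℂ f U) (x : U) :
    (zerosIn U f).mult x = analyticOrderNatAt f x := by
  rw [zerosIn, dif_pos hf]

/-- Near each point, linear statistics of zeros converge. -/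
lemma exists_isOpen_tendsto_linStat_zerosIn {ι : Type*} {l : Filter ι} {U : Set ℂ} (hU : IsOpen U)
    {F : ι → ℂ → ℂ} {f : ℂ → ℂ} (hF : ∀ᶠ i in l, AnalyticOnNhd ℂ (F i) U)
    (hf : AnalyticOnNhd ℂ f U) (hlim : TendstoLocallyUniformlyOn F f l U) (x : U)
    (hx : analyticOrderAt f x ≠ ⊤) :
    ∃ V : Set U, IsOpen V ∧ x ∈ V ∧ ∀ φ : U → ℝ, Continuous φ → tsupport φ ⊆ V →
      Tendsto (fun i => PointConfig.linStat φ (zerosIn U (F i))) l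
        (𝓝 (PointConfig.linStat φ (zerosIn U f))) := by
  have hev : ∀ᶠ z in 𝓝 (x : ℂ), z ∈ U ∧ (z ≠ x → f z ≠ 0) := by
    refine (hU.eventually_mem x.2).and ?_
    exact eventually_nhdsWithin_iff.1
      ((hf x x.2).eventually_eq_zero_or_eventually_ne_zero.resolve_left
        fun h => hx (analyticOrderAt_eq_top.2 h))
  obtain ⟨r₀, hr₀, hball⟩ := Metric.nhds_basis_closedBall.mem_iff.1 hev
  have hsub : Metric.closedBall (x : ℂ) r₀ ⊆ U := fun z hz => (hball hz).1
  have hunif : TendstoUniformlyOn F f l (Metric.closedBall (x : ℂ) r₀) :=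
    (tendstoLocallyUniformlyOn_iff_forall_isCompact hU).1 hlim _ hsub (isCompact_closedBall _ _)
  refine ⟨Metric.ball x r₀, Metric.isOpen_ball, Metric.mem_ball_self hr₀, fun φ hφ hsupp => ?_⟩
  have hφ0 (y : U) (hy : (y : ℂ) ∉ Metric.closedBall (x : ℂ) r₀) : φ y = 0 :=
    image_eq_zero_of_notMem_tsupport fun h => hy (Metric.ball_subset_closedBall (hsupp h))
  set m := analyticOrderNatAt f x with hm
  have hlimit : PointConfig.linStat φ (zerosIn U f) = m * φ x := by
    rw [PointConfig.linStat, finsum_eq_single _ x, zerosIn_mult hf]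
    intro y hy
    by_cases hyr : (y : ℂ) ∈ Metric.closedBall (x : ℂ) r₀
    · have hne := (hball hyr).2 fun h => hy (Subtype.ext h)
      rw [zerosIn_mult hf, show analyticOrderNatAt f y = 0 from
        by_contra fun h => hne (apply_eq_zero_of_analyticOrderNatAt_ne_zero h)]
      simp
    · rw [hφ0 y hyr, mul_zero]
  rw [hlimit, Metric.tendsto_nhds]
  intro ε hε
  -- The zeros near `x` have total multiplicity `m`, so the error is at most `m * (ε / (m + 1)) <
  -- ε`.
  obtain ⟨r, hr, hφr⟩ := Metric.continuous_iff.1 hφ x (ε / (m + 1)) (by positivity)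
  filter_upwards [hF, eventually_exists_finset_zeros (lt_min hr (half_pos hr₀))
    ((min_le_right _ _).trans_lt (half_lt_self hr₀)) (hF.mono fun i h => h.mono hsub)
    (hf.mono hsub) (fun z hz => (hball hz).2) hunif] with i hFi ⟨S, hS₁, hS₂, hS⟩
  have hSU (u : ℂ) (hu : u ∈ S) : u ∈ U := hsub <| Metric.mem_closedBall.2 <|
    (hS₁ u hu).le.trans ((min_le_right _ _).trans (half_le_self hr₀.le))
  classical
  have hstat : PointConfig.linStat φ (zerosIn U (F i))
      = ∑ y ∈ S.subtype (· ∈ U), (analyticOrderNatAt (F i) y : ℝ) * φ y := by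
    rw [PointConfig.linStat, finsum_eq_sum_of_support_subset (s := S.subtype (· ∈ U))]
    · exact Finset.sum_congr rfl fun y _ => by rw [zerosIn_mult hFi]
    · intro y hy
      have h := mul_ne_zero_iff.1 hy
      rw [zerosIn_mult hFi] at h
      refine Finset.mem_coe.2 (Finset.mem_subtype.2 (hS₂ y ?_
        (apply_eq_zero_of_analyticOrderNatAt_ne_zero (by exact_mod_cast h.1))))
      by_contra hyr
      exact h.2 (hφ0 y hyr)
  have hcount : ∑ y ∈ S.subtype (· ∈ U), (analyticOrderNatAt (F i) y : ℝ) = m := by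
    rw [Finset.sum_subtype_of_mem (fun u => (analyticOrderNatAt (F i) u : ℝ)) hSU, ← Nat.cast_sum,
      hS]
  rw [hstat, ← hcount, Finset.sum_mul, Real.dist_eq, ← Finset.sum_sub_distrib]
  calc |∑ y ∈ S.subtype (· ∈ U), ((analyticOrderNatAt (F i) y : ℝ) * φ y
          - analyticOrderNatAt (F i) y * φ x)|
      ≤ ∑ y ∈ S.subtype (· ∈ U), (analyticOrderNatAt (F i) y : ℝ) * (ε / (m + 1)) := by
        refine (Finset.abs_sum_le_sum_abs _ _).trans (Finset.sum_le_sum fun y hy => ?_)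
        rw [← mul_sub, abs_mul, Nat.abs_cast]
        gcongr
        exact (hφr y ((hS₁ y (Finset.mem_subtype.1 hy)).trans_le (min_le_left _ _))).le
    _ = m * (ε / (m + 1)) := by rw [← Finset.sum_mul, hcount]
    _ < ε := by
        rw [← mul_div_assoc, div_lt_iff₀ (by positivity)]
        nlinarith

/-- **Hurwitz's theorem**: the zeros depend continuously, in the vague topology, on the
holomorphic function in the topology of locally uniform convergence. -/
theorem tendsto_zerosIn {ι : Type*} {l : Filter ι} {U : Set ℂ} (hU : IsOpen U)
    {F : ι → ℂ → ℂ} {f : ℂ → ℂ} (hF : ∀ᶠ i in l, AnalyticOnNhd ℂ (F i) U)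
    (hf : AnalyticOnNhd ℂ f U) (hlim : TendstoLocallyUniformlyOn F f l U)
    (hne : ∀ x ∈ U, analyticOrderAt f x ≠ ⊤) :
    Tendsto (fun i => zerosIn U (F i)) l (𝓝 (zerosIn U f)) := by
  have : LocallyCompactSpace U := hU.locallyCompactSpace
  rw [PointConfig.tendsto_iff]
  intro φ
  choose V hVo hxV hV using fun x : U =>
    exists_isOpen_tendsto_linStat_zerosIn hU hF hf hlim x (hne x x.2)
  have hφ := φ.hasCompactSupport
  obtain ⟨t, ht⟩ := hφ.isCompact.elim_finite_subcover V hVo fun x _ => Set.mem_iUnion.2 ⟨x, hxV x⟩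
  -- A partition of unity splits `φ` into pieces each supported in a set where the local statement
  -- applies.
  obtain ⟨g, hg, hg1, -, -⟩ := exists_continuous_sum_one_of_isOpen_isCompact
    (s := fun j => V (t.equivFin.symm j)) (fun j => hVo _) hφ.isCompact (by
      intro x hx
      obtain ⟨y, hy, hxy⟩ := Set.mem_iUnion₂.1 (ht hx)
      exact Set.mem_iUnion.2 ⟨t.equivFin ⟨y, hy⟩, by simpa using hxy⟩)
  have hdecomp : (φ : U → ℝ) = fun x => ∑ j, g j x * φ x := by
    ext x
    rw [← Finset.sum_mul]
    by_cases hx : x ∈ tsupport φ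
    · have := hg1 hx
      simp only [Finset.sum_apply, Pi.one_apply] at this
      rw [this, one_mul]
    · rw [image_eq_zero_of_notMem_tsupport hx, mul_zero]
  have hcs (j) : HasCompactSupport fun x => g j x * φ x :=
    hφ.mul_left
  rw [hdecomp]
  simp only [fun P => PointConfig.linStat_sum P Finset.univ fun j _ => hcs j]
  exact tendsto_finsetSum _ fun j _ => hV _ _ ((g j).continuous.mul φ.continuous)
    ((tsupport_mul_subset_left).trans (hg j))

/-! ### The potential of a rotationally invariant measure. -/

section Potential

variable {ν : Measure ℂ}

lemma logPotential_mul_of_norm_eq_one (hν : IsBackground ν) {c : ℂ} (hc : ‖c‖ = 1) (z : ℂ) :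
    logPotential ν (c * z) = logPotential ν z := by
  have hmeas : Measurable fun w : ℂ => Real.log ‖c * z - w‖ :=
    Real.measurable_log.comp (by fun_prop)
  rw [logPotential, ← hν.rotationInvariant c hc,
    integral_map (by fun_prop) hmeas.aestronglyMeasurable, hν.rotationInvariant c hc, logPotential]
  refine integral_congr_ae (Eventually.of_forall fun w => ?_)
  simp only [← mul_sub, norm_mul, hc, one_mul]

lemma logPotential_circleMap (hν : IsBackground ν) {z : ℂ} (hz : z ≠ 0) (θ : ℝ) :
    logPotential ν (circleMap 0 ‖z‖ θ) = logPotential ν z := by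
  rw [← div_mul_cancel₀ (circleMap 0 ‖z‖ θ) hz]
  exact logPotential_mul_of_norm_eq_one hν (by simp [hz]) z

lemma ae_ne_zero_of_isBackground (hν : IsBackground ν) : ∀ᵐ z ∂ν, z ≠ 0 := by
  rw [ae_iff]
  simpa using hν.zero_not_atom

/-- Reduces a bound on the circle integral of $|\log|$ to an upper bound on $\log^+$, the circle
integral of $\log$ being explicit. -/
lemma abs_log_eq_two_mul_posLog_sub (x : ℝ) : |Real.log x| = 2 * Real.posLog x - Real.log x := by
  rw [← Real.half_mul_log_add_log_abs]
  ring

lemma integrable_posLog_norm (hν : IsBackground ν) :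
    Integrable (fun w : ℂ => Real.posLog ‖w‖) ν := by
  refine hν.integrable_log.mono (Real.continuous_posLog.comp continuous_norm).aestronglyMeasurable
    (Eventually.of_forall fun w => ?_)
  rw [Real.norm_eq_abs, Real.norm_eq_abs, abs_of_nonneg Real.posLog_nonneg, Real.posLog_apply]
  exact max_le (abs_nonneg _) (le_abs_self _)

lemma integral_log_norm_circleMap_sub {r : ℝ} (hr : 0 < r) (w : ℂ) :
    ∫ θ in Set.Ioc 0 (2 * Real.pi), Real.log ‖circleMap 0 r θ - w‖
      = 2 * Real.pi * (Real.log r + Real.posLog (r⁻¹ * ‖w‖)) := by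
  have h := circleAverage_log_norm_sub_const_eq_log_radius_add_posLog (a := w) (c := 0) hr.ne'
  rw [Real.circleAverage, intervalIntegral.integral_of_le Real.two_pi_pos.le, zero_sub, norm_neg,
    smul_eq_mul, inv_mul_eq_iff_eq_mul₀ Real.two_pi_pos.ne'] at h
  exact h

lemma integrable_log_norm_circleMap_sub {r : ℝ} (w : ℂ) :
    IntegrableOn (fun θ => Real.log ‖circleMap 0 r θ - w‖) (Set.Ioc 0 (2 * Real.pi)) := by
  have h : CircleIntegrable (fun z => Real.log ‖z - w‖) 0 r := circleIntegrable_log_norm_sub_const r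
  rw [CircleIntegrable, intervalIntegrable_iff_integrableOn_Ioc_of_le Real.two_pi_pos.le] at h
  exact h

/-- Justifies Fubini when the potential is averaged over a circle. -/
lemma integrable_prod_log_norm_circleMap_sub [IsProbabilityMeasure ν] (hν : IsBackground ν) {r : ℝ}
    (hr : 0 < r) :
    Integrable (fun p : ℝ × ℂ => Real.log ‖circleMap 0 r p.1 - p.2‖)
      ((volume.restrict (Set.Ioc 0 (2 * Real.pi))).prod ν) := by
  have hmeas : Measurable fun p : ℝ × ℂ => Real.log ‖circleMap 0 r p.1 - p.2‖ := by
    refine Real.measurable_log.comp (Continuous.measurable ?_)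
    exact (((continuous_circleMap 0 r).comp continuous_fst).sub continuous_snd).norm
  rw [integrable_prod_iff' hmeas.aestronglyMeasurable]
  refine ⟨Eventually.of_forall fun w => integrable_log_norm_circleMap_sub w, ?_⟩
  -- The majorant comes from $|\log|=2\log^+-\log$: the first term by subadditivity of $\log^+$ up
  -- to $\log 2$, the second because the circle integral of $\log$ is at least $2\pi\log r$.
  refine Integrable.mono' (g := fun w => 2 * (2 * Real.pi * (Real.log 2 + Real.posLog r
    + Real.posLog ‖w‖)) - 2 * Real.pi * Real.log r) ?_ ?_ ?_
  · exact ((((integrable_const _).add (integrable_posLog_norm hν)).const_mul _).const_mul _).sub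
      (integrable_const _)
  · exact (hmeas.norm.stronglyMeasurable.integral_prod_left').aestronglyMeasurable
  · refine Eventually.of_forall fun w => ?_
    have hpos : IntegrableOn (fun θ => Real.posLog ‖circleMap 0 r θ - w‖)
        (Set.Ioc 0 (2 * Real.pi)) :=
      (Continuous.integrableOn_Icc (by
        exact Real.continuous_posLog.comp
          ((continuous_circleMap 0 r).sub continuous_const).norm)).mono_set Set.Ioc_subset_Icc_self
    rw [Real.norm_of_nonneg (integral_nonneg fun _ => norm_nonneg _)]
    simp only [Real.norm_eq_abs, abs_log_eq_two_mul_posLog_sub]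
    rw [integral_sub (hpos.const_mul 2) (integrable_log_norm_circleMap_sub w),
      integral_log_norm_circleMap_sub hr, integral_const_mul]
    have hle : ∫ θ in Set.Ioc 0 (2 * Real.pi), Real.posLog ‖circleMap 0 r θ - w‖
        ≤ 2 * Real.pi * (Real.log 2 + Real.posLog r + Real.posLog ‖w‖) := by
      calc _ ≤ ∫ _ in Set.Ioc 0 (2 * Real.pi), (Real.log 2 + Real.posLog r + Real.posLog ‖w‖) := by
            refine integral_mono hpos (integrable_const _) fun θ => ?_
            have h := Real.posLog_norm_add_le (circleMap 0 r θ) (-w)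
            rw [← sub_eq_add_neg, norm_neg, norm_circleMap_zero, Real.posLog_abs] at h
            simp only
            linarith
        _ = _ := by simp [Real.pi_pos.le]
    have : 0 ≤ 2 * Real.pi * Real.posLog (r⁻¹ * ‖w‖) :=
      mul_nonneg Real.two_pi_pos.le Real.posLog_nonneg
    linarith

/-- For a rotationally invariant measure, the logarithm in the potential may be replaced by its
average over the circle. -/
lemma logPotential_eq_integral_posLog [IsProbabilityMeasure ν] (hν : IsBackground ν) {z : ℂ}
    (hz : z ≠ 0) :
    logPotential ν z = ∫ w, (Real.log ‖z‖ + Real.posLog (‖z‖⁻¹ * ‖w‖)) ∂ν := by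
  have hr : 0 < ‖z‖ := norm_pos_iff.2 hz
  have h1 : ∫ θ in Set.Ioc 0 (2 * Real.pi), logPotential ν (circleMap 0 ‖z‖ θ)
      = 2 * Real.pi * logPotential ν z := by
    simp [logPotential_circleMap hν hz, Real.pi_pos.le]
  simp only [logPotential] at h1
  rw [integral_integral_swap (integrable_prod_log_norm_circleMap_sub hν hr)] at h1
  simp only [integral_log_norm_circleMap_sub hr] at h1
  rw [integral_const_mul] at h1
  exact (mul_left_cancel₀ Real.two_pi_pos.ne' h1).symm

end Potential

/-! ### Concentration of the penalized measures. -/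

section Concentration

variable {X : Type*} [MeasurableSpace X]

/-- The mean excess of `s x` over an independent value of `s`. -/
noncomputable def meanExcess (ν : Measure X) (s : X → ℝ) (x : X) : ℝ :=
  ∫ y, max (s x - s y) 0 ∂ν

/-- The exponential moment of order `2 j` of `s`, penalized by the mean excess. -/
noncomputable def penalizedMoment (ν : Measure X) (s : X → ℝ) (n j : ℕ) : ℝ :=
  ∫ x, Real.exp (2 * j * s x - 2 * n * meanExcess ν s x) ∂ν

variable {ν : Measure X} {s : X → ℝ}

lemma meanExcess_nonneg (x : X) : 0 ≤ meanExcess ν s x :=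
  integral_nonneg fun _ => le_max_right _ _

lemma measurable_meanExcess [SFinite ν] (hs : Measurable s) : Measurable (meanExcess ν s) := by
  have h : Measurable fun p : X × X => max (s p.1 - s p.2) 0 := by fun_prop
  exact (h.stronglyMeasurable.integral_prod_right').measurable

variable [IsProbabilityMeasure ν]

lemma integrable_max_sub (hi : Integrable s ν) (x : X) :
    Integrable (fun y => max (s x - s y) 0) ν :=
  ((integrable_const _).sub hi).pos_part

lemma sub_integral_le_meanExcess (hi : Integrable s ν) (x : X) :
    s x - ∫ y, s y ∂ν ≤ meanExcess ν s x := by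
  calc s x - ∫ y, s y ∂ν = ∫ y, (s x - s y) ∂ν := by
        rw [integral_sub (integrable_const _) hi]; simp
    _ ≤ _ := integral_mono ((integrable_const _).sub hi) (integrable_max_sub hi x)
        fun y => le_max_left _ _

lemma meanExcess_le (hi : Integrable s ν) (h0 : ∀ᵐ y ∂ν, 0 ≤ s y) {x : X} (hx : 0 ≤ s x) :
    meanExcess ν s x ≤ s x := by
  calc meanExcess ν s x ≤ ∫ _, s x ∂ν :=
        integral_mono_ae (integrable_max_sub hi x) (integrable_const _)
          (h0.mono fun y hy => max_le (by linarith) hx)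
    _ = s x := by simp

/-- Every `y` with `s y < ε / 2` contributes at least `ε / 2` to the excess. -/
lemma le_meanExcess (hs : Measurable s) (hi : Integrable s ν) {ε : ℝ} {x : X}
    (hx : ε ≤ s x) : ν.real {y | s y < ε / 2} * (ε / 2) ≤ meanExcess ν s x := by
  have hm : MeasurableSet {y | s y < ε / 2} := measurableSet_lt hs measurable_const
  calc ν.real {y | s y < ε / 2} * (ε / 2) = ∫ y, {y | s y < ε / 2}.indicator (fun _ => ε / 2) y ∂ν := by
        rw [integral_indicator hm]; simp
    _ ≤ meanExcess ν s x := by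
        refine integral_mono ((integrable_const _).indicator hm) (integrable_max_sub hi x)
          fun y => ?_
        by_cases hy : s y < ε / 2
        · rw [Set.indicator_of_mem (by exact hy)]
          exact le_max_of_le_left (by linarith)
        · rw [Set.indicator_of_notMem (by exact hy)]
          exact le_max_right _ _

/-- Of the `n` units of penalty, `j` absorb the growth of `2 * j * s x`, since the excess is at
least `s x` minus the mean; `n - j` units remain. -/
lemma exponent_le (hi : Integrable s ν) (n j : ℕ) (x : X) :
    2 * j * s x - 2 * n * meanExcess ν s x
      ≤ 2 * j * (∫ y, s y ∂ν) - 2 * ((n : ℝ) - j) * meanExcess ν s x := by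
  have h := mul_le_mul_of_nonneg_left (sub_integral_le_meanExcess hi x)
    (by positivity : (0 : ℝ) ≤ 2 * j)
  linarith

lemma integrable_exp_penalized (hs : Measurable s) (hi : Integrable s ν) {n j : ℕ} (hj : j ≤ n) :
    Integrable (fun x => Real.exp (2 * j * s x - 2 * n * meanExcess ν s x)) ν := by
  refine Integrable.of_bound (C := Real.exp (2 * j * ∫ y, s y ∂ν)) ?_
    (Eventually.of_forall fun x => ?_)
  · have := measurable_meanExcess (ν := ν) hs
    exact (by fun_prop : Measurable fun x =>
      Real.exp (2 * j * s x - 2 * n * meanExcess ν s x)).aestronglyMeasurable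
  · rw [Real.norm_of_nonneg (Real.exp_pos _).le, Real.exp_le_exp]
    refine (exponent_le hi n j x).trans ?_
    have : 0 ≤ 2 * ((n : ℝ) - j) * meanExcess ν s x :=
      mul_nonneg (mul_nonneg zero_le_two (sub_nonneg.2 (by exact_mod_cast hj)))
        (meanExcess_nonneg x)
    linarith

lemma penalizedMoment_zero_pos (hs : Measurable s) (hi : Integrable s ν) (n : ℕ) :
    0 < penalizedMoment ν s n 0 :=
  integral_exp_pos (integrable_exp_penalized hs hi (Nat.zero_le n))

lemma penalizedMoment_zero_le (hs : Measurable s) (hi : Integrable s ν) (h0 : ∀ᵐ y ∂ν, 0 ≤ s y)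
    {n j : ℕ} (hj : j ≤ n) : penalizedMoment ν s n 0 ≤ penalizedMoment ν s n j := by
  refine integral_mono_ae (integrable_exp_penalized hs hi (Nat.zero_le n))
    (integrable_exp_penalized hs hi hj) (h0.mono fun x hx => ?_)
  simp only [Real.exp_le_exp, Nat.cast_zero, mul_zero, zero_mul, zero_sub]
  have : 0 ≤ 2 * (j : ℝ) * s x := by positivity
  linarith

lemma penalizedMoment_pos (hs : Measurable s) (hi : Integrable s ν) {n j : ℕ} (hj : j ≤ n) :
    0 < penalizedMoment ν s n j :=
  integral_exp_pos (integrable_exp_penalized hs hi hj)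

/-- Where `s < δ / 2` the excess is at most `s`, hence below `δ / 2`, and the integrand is at least
`exp (-(n * δ))`. -/
lemma exp_mul_measureReal_le_penalizedMoment (hs : Measurable s) (hi : Integrable s ν)
    (h0 : ∀ᵐ y ∂ν, 0 ≤ s y) (n : ℕ) (δ : ℝ) :
    Real.exp (-(n * δ)) * ν.real {y | s y < δ / 2} ≤ penalizedMoment ν s n 0 := by
  have hm : MeasurableSet {y | s y < δ / 2} := measurableSet_lt hs measurable_const
  calc Real.exp (-(n * δ)) * ν.real {y | s y < δ / 2}
      = ∫ y, {y | s y < δ / 2}.indicator (fun _ => Real.exp (-(n * δ))) y ∂ν := by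
        rw [integral_indicator hm]; simp [mul_comm]
    _ ≤ _ := by
        refine integral_mono_ae ((integrable_const _).indicator hm)
          (integrable_exp_penalized hs hi (Nat.zero_le n)) (h0.mono fun y hy => ?_)
        by_cases hyδ : s y < δ / 2
        · simp only [Set.indicator_of_mem (show y ∈ {y | s y < δ / 2} from hyδ), Real.exp_le_exp,
            Nat.cast_zero, mul_zero, zero_mul, zero_sub]
          have : (n : ℝ) * meanExcess ν s y ≤ n * (δ / 2) := by
            gcongr
            exact (meanExcess_le hi h0 hy).trans hyδ.le
          linarith
        · rw [Set.indicator_of_notMem (by exact hyδ)]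
          exact (Real.exp_pos _).le

/-- The domain is split at `s = ε`: below, the factor `exp (2 * j * s)` is at most `exp (2 * j *
ε)`; above, `exponent_le` leaves a penalty of `2 * (n - j) * δ`. -/
lemma penalizedMoment_le (hs : Measurable s) (hi : Integrable s ν) {ε δ : ℝ}
    (hδ : ∀ x, ε ≤ s x → δ ≤ meanExcess ν s x) {n j : ℕ} (hj : j ≤ n) :
    penalizedMoment ν s n j ≤ Real.exp (2 * j * ε) * penalizedMoment ν s n 0
      + Real.exp (2 * j * (∫ y, s y ∂ν) + 2 * j * δ) * Real.exp (-(2 * n * δ)) := by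
  have hi0 := integrable_exp_penalized (ν := ν) hs hi (Nat.zero_le n)
  calc penalizedMoment ν s n j
      ≤ ∫ x, (Real.exp (2 * j * ε) * Real.exp (2 * (0 : ℕ) * s x - 2 * n * meanExcess ν s x)
          + Real.exp (2 * j * (∫ y, s y ∂ν) + 2 * j * δ) * Real.exp (-(2 * n * δ))) ∂ν := by
        refine integral_mono (integrable_exp_penalized hs hi hj)
          ((hi0.const_mul _).add (integrable_const _)) fun x => ?_
        simp only [← Real.exp_add]
        by_cases hx : ε ≤ s x
        · refine le_add_of_nonneg_of_le (Real.exp_pos _).le (Real.exp_le_exp.2 ?_)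
          refine (exponent_le hi n j x).trans ?_
          have : 2 * ((n : ℝ) - j) * δ ≤ 2 * ((n : ℝ) - j) * meanExcess ν s x :=
            mul_le_mul_of_nonneg_left (hδ x hx)
              (mul_nonneg zero_le_two (sub_nonneg.2 (by exact_mod_cast hj)))
          linarith
        · refine le_add_of_le_of_nonneg (Real.exp_le_exp.2 ?_) (Real.exp_pos _).le
          have : 2 * (j : ℝ) * s x ≤ 2 * j * ε := by
            gcongr
            exact (not_le.1 hx).le
          simp only [Nat.cast_zero, mul_zero, zero_mul, zero_sub]
          linarith
    _ = _ := by
        rw [integral_add (hi0.const_mul _) (integrable_const _), integral_const_mul]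
        simp [penalizedMoment]

/-- The penalized measures concentrate where `s` is close to its essential infimum `0`. -/
lemma tendsto_penalizedMoment_div (hs : Measurable s) (hi : Integrable s ν)
    (h0 : ∀ᵐ y ∂ν, 0 ≤ s y) (hpos : ∀ ε > 0, 0 < ν {y | s y < ε}) (j : ℕ) :
    Tendsto (fun n => penalizedMoment ν s n j / penalizedMoment ν s n 0) atTop (𝓝 1) := by
  have hreal {ε : ℝ} (hε : 0 < ε) : 0 < ν.real {y | s y < ε} :=
    ENNReal.toReal_pos (hpos ε hε).ne' (measure_ne_top _ _)
  rw [tendsto_order]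
  constructor
  · intro a ha
    filter_upwards [eventually_ge_atTop j] with n hn
    exact ha.trans_le ((one_le_div (penalizedMoment_zero_pos hs hi n)).2
      (penalizedMoment_zero_le hs hi h0 hn))
  · intro a ha
    obtain ⟨ε, hε, hεa⟩ : ∃ ε > 0, Real.exp (2 * j * ε) < a := by
      have hc : Tendsto (fun ε : ℝ => Real.exp (2 * j * ε)) (𝓝[>] 0) (𝓝 1) := by
        have : Continuous fun ε : ℝ => Real.exp (2 * j * ε) := by fun_prop
        simpa using (this.tendsto 0).mono_left nhdsWithin_le_nhds
      exact ((eventually_mem_nhdsWithin (a := (0 : ℝ)) (s := Set.Ioi 0)).and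
        (hc.eventually_lt_const ha)).exists
    -- This `δ` bounds the excess from below on `s ≥ ε`. The tail then decays like `exp (-(2 * n *
    -- δ))`, while the moment of order zero is at least `p * exp (-(n * δ))`, so their ratio tends
    -- to zero.
    set δ := ν.real {y | s y < ε / 2} * (ε / 2) with hδdef
    have hδ : 0 < δ := mul_pos (hreal (half_pos hε)) (half_pos hε)
    set p := ν.real {y | s y < δ / 2} with hp
    have hp0 : 0 < p := hreal (half_pos hδ)
    set K := Real.exp (2 * j * (∫ y, s y ∂ν) + 2 * j * δ) with hK
    have hlim : Tendsto (fun n : ℕ => Real.exp (2 * j * ε) + K / p * Real.exp (-(n * δ))) atTop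
        (𝓝 (Real.exp (2 * j * ε) + K / p * 0)) := by
      refine tendsto_const_nhds.add (Tendsto.const_mul _ ?_)
      exact Real.tendsto_exp_neg_atTop_nhds_zero.comp
        (tendsto_natCast_atTop_atTop.atTop_mul_const hδ)
    rw [mul_zero, add_zero] at hlim
    filter_upwards [eventually_ge_atTop j, hlim.eventually_lt_const hεa] with n hn hna
    refine lt_of_le_of_lt ?_ hna
    have hN := penalizedMoment_zero_pos (ν := ν) hs hi n
    rw [div_le_iff₀ hN]
    refine (penalizedMoment_le (ε := ε) (δ := δ) hs hi (fun x hx => le_meanExcess hs hi hx) hn).trans ?_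
    rw [add_mul]
    refine add_le_add le_rfl ?_
    have hlow := exp_mul_measureReal_le_penalizedMoment (ν := ν) hs hi h0 n δ
    calc K * Real.exp (-(2 * n * δ))
        = K / p * Real.exp (-(n * δ)) * (Real.exp (-(n * δ)) * p) := by
          rw [show -(2 * n * δ) = -(n * δ) + -(n * δ) by ring, Real.exp_add]
          field_simp
      _ ≤ _ := mul_le_mul_of_nonneg_left hlow (by positivity)

end Concentration

/-! ### Weighted partial sums of power series and their zeros. -/

section PowerSeries

/-- The coefficients of a power series converging in the unit disk. -/
def IsSubexponential (a : ℕ → ℂ) : Prop :=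
  ∀ ρ : ℝ, 0 ≤ ρ → ρ < 1 → Summable fun k => ‖a k‖ * ρ ^ k

/-- The partial sum of the power series with coefficients `a`, weighted by `b`. -/
noncomputable def weightedSum (b : ℕ → ℝ) (n : ℕ) (a : ℕ → ℂ) (w : ℂ) : ℂ :=
  ∑ k ∈ Finset.range (n + 1), a k * b k * w ^ k

lemma isOpen_disk (R : ℝ) : IsOpen (disk R) := isOpen_lt continuous_norm continuous_const

lemma isOpen_exteriorDisk (R : ℝ) : IsOpen (exteriorDisk R) :=
  isOpen_lt continuous_const continuous_norm

lemma disk_eq_ball (R : ℝ) : disk R = Metric.ball 0 R := by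
  ext z
  simp [disk]

lemma IsSubexponential.summable {a : ℕ → ℂ} (ha : IsSubexponential a) {w : ℂ} (hw : w ∈ disk 1) :
    Summable fun k => a k * w ^ k :=
  .of_norm (by simpa using ha ‖w‖ (norm_nonneg w) hw)

/-- Dominated convergence for series, with majorant `‖a k‖ * ρ ^ k` on the disk of radius `ρ < 1`.
-/
lemma tendstoLocallyUniformlyOn_weightedSum {a : ℕ → ℂ} (ha : IsSubexponential a)
    {b : ℕ → ℕ → ℝ} (hb0 : ∀ n j, j ≤ n → 0 ≤ b n j) (hb1 : ∀ n j, j ≤ n → b n j ≤ 1)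
    (hb : ∀ j, Tendsto (fun n => b n j) atTop (𝓝 1)) :
    TendstoLocallyUniformlyOn (fun n => weightedSum (b n) n a) (coeffSeries a) atTop (disk 1) := by
  rw [Metric.tendstoLocallyUniformlyOn_iff]
  intro ε hε x hx
  obtain ⟨ρ, hxρ, hρ⟩ := exists_between (show ‖x‖ < 1 from hx)
  have hρ0 : 0 ≤ ρ := (norm_nonneg x).trans hxρ.le
  -- Extending the weights by zero turns the finite sum into a full series.
  let c : ℕ → ℕ → ℝ := fun n k => if k ≤ n then b n k else 0
  have hc (n k : ℕ) : ‖1 - c n k‖ ≤ 1 := by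
    rw [Real.norm_eq_abs, abs_le]
    by_cases h : k ≤ n
    · simp only [c, if_pos h]
      constructor <;> linarith [hb0 n k h, hb1 n k h]
    · simp [c, h]
  have hclim (k : ℕ) : Tendsto (fun n => c n k) atTop (𝓝 1) :=
    (hb k).congr' ((eventually_ge_atTop k).mono fun n hn => (if_pos hn).symm)
  have hlim : Tendsto (fun n => ∑' k, ‖a k‖ * ρ ^ k * ‖1 - c n k‖) atTop
      (𝓝 (∑' k, ‖a k‖ * ρ ^ k * 0)) := by
    refine tendsto_tsum_of_dominated_convergence (ha ρ hρ0 hρ) (fun k => ?_)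
      (Eventually.of_forall fun n k => ?_)
    · refine Tendsto.const_mul _ ?_
      simpa using ((hclim k).const_sub 1).norm
    · rw [Real.norm_of_nonneg (by positivity)]
      exact mul_le_of_le_one_right (by positivity) (hc n k)
  simp only [mul_zero, tsum_zero] at hlim
  refine ⟨Metric.ball 0 ρ, mem_nhdsWithin_of_mem_nhds
    (Metric.isOpen_ball.mem_nhds (by simpa using hxρ)), ?_⟩
  filter_upwards [hlim.eventually_lt_const hε] with n hn y hy
  have hyρ : ‖y‖ ≤ ρ := by simpa using (Metric.mem_ball.1 hy).le
  have hsum : Summable fun k => ‖a k‖ * ρ ^ k * ‖1 - c n k‖ :=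
    .of_nonneg_of_le (fun k => by positivity)
      (fun k => mul_le_of_le_one_right (by positivity) (hc n k)) (ha ρ hρ0 hρ)
  have hle (k : ℕ) : ‖a k * y ^ k * (1 - c n k : ℝ)‖ ≤ ‖a k‖ * ρ ^ k * ‖1 - c n k‖ := by
    rw [norm_mul, norm_mul, norm_pow, Complex.norm_real]
    gcongr
  have hw : weightedSum (b n) n a y = ∑' k, a k * y ^ k * (c n k : ℝ) := by
    rw [tsum_eq_sum (s := Finset.range (n + 1)), weightedSum]
    · refine Finset.sum_congr rfl fun k hk => ?_
      simp only [c, if_pos (Nat.lt_succ_iff.1 (Finset.mem_range.1 hk))]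
      ring
    · intro k hk
      have : ¬ k ≤ n := fun h => hk (Finset.mem_range.2 (Nat.lt_succ_of_le h))
      simp [c, this]
  have hs1 : Summable fun k => a k * y ^ k := ha.summable (hyρ.trans_lt hρ)
  have hs2 : Summable fun k => a k * y ^ k * (c n k : ℝ) := by
    refine summable_of_ne_finset_zero (s := Finset.range (n + 1)) fun k hk => ?_
    have : ¬ k ≤ n := fun h => hk (Finset.mem_range.2 (Nat.lt_succ_of_le h))
    simp [c, this]
  rw [dist_eq_norm, coeffSeries, hw, ← hs1.tsum_sub hs2]
  calc ‖∑' k, (a k * y ^ k - a k * y ^ k * (c n k : ℝ))‖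
      = ‖∑' k, a k * y ^ k * (1 - c n k : ℝ)‖ := by
        congr 2 with k
        push_cast
        ring
    _ ≤ ∑' k, ‖a k‖ * ρ ^ k * ‖1 - c n k‖ := tsum_of_norm_bounded hsum.hasSum hle
    _ < ε := hn

lemma differentiable_weightedSum (b : ℕ → ℝ) (n : ℕ) (a : ℕ → ℂ) :
    Differentiable ℂ (weightedSum b n a) := by
  unfold weightedSum
  fun_prop

lemma analyticOnNhd_weightedSum_comp {U : Set ℂ} {ψ : ℂ → ℂ} (hψ : AnalyticOnNhd ℂ ψ U)
    (b : ℕ → ℝ) (n : ℕ) (a : ℕ → ℂ) : AnalyticOnNhd ℂ (fun z => weightedSum b n a (ψ z)) U :=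
  fun x hx => ((differentiable_weightedSum b n a).analyticAt _).comp (hψ x hx)

lemma IsSubexponential.analyticOnNhd {a : ℕ → ℂ} (ha : IsSubexponential a) :
    AnalyticOnNhd ℂ (coeffSeries a) (disk 1) := by
  refine DifferentiableOn.analyticOnNhd ?_ (isOpen_disk 1)
  exact (tendstoLocallyUniformlyOn_weightedSum ha (b := fun _ _ => 1) (by simp) (by simp)
    (fun _ => tendsto_const_nhds)).differentiableOn
    (Eventually.of_forall fun n => (differentiable_weightedSum _ n a).differentiableOn)
    (isOpen_disk 1)

lemma IsSubexponential.analyticOrderAt_ne_top {a : ℕ → ℂ} (ha : IsSubexponential a) (h0 : a 0 ≠ 0)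
    {w : ℂ} (hw : w ∈ disk 1) : analyticOrderAt (coeffSeries a) w ≠ ⊤ := by
  have h0mem : (0 : ℂ) ∈ disk 1 := by simp [disk]
  have hpre : IsPreconnected (disk 1) := by
    rw [disk_eq_ball]
    exact (convex_ball 0 1).isPreconnected
  refine ha.analyticOnNhd.analyticOrderAt_ne_top_of_isPreconnected hpre h0mem hw ?_
  have : coeffSeries a 0 = a 0 := by
    rw [coeffSeries, tsum_eq_single 0 fun k hk => by simp [hk]]
    simp
  rw [(ha.analyticOnNhd 0 h0mem).analyticOrderAt_eq_zero.2 (by rwa [this])]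
  exact ENat.zero_ne_top

open Polynomial in
lemma analyticOrderAt_weightedSum_ne_top {b : ℕ → ℝ} {n : ℕ} {a : ℕ → ℂ}
    (h : ∃ k ≤ n, a k ≠ 0 ∧ b k ≠ 0) (w : ℂ) : analyticOrderAt (weightedSum b n a) w ≠ ⊤ := by
  intro htop
  obtain ⟨k, hk, hak, hbk⟩ := h
  let p : ℂ[X] := ∑ k ∈ Finset.range (n + 1), C (a k * b k) * X ^ k
  have hp (z : ℂ) : p.eval z = weightedSum b n a z := by
    simp [p, weightedSum, eval_finsetSum]
  have hp0 : p = 0 := by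
    refine eq_zero_of_infinite_isRoot p
      (infinite_of_mem_nhds w ((analyticOrderAt_eq_top.1 htop).mono fun z hz => ?_))
    exact (hp z).trans hz
  have hcoeff : p.coeff k = a k * b k := by
    simp only [p, finsetSum_coeff, coeff_C_mul_X_pow]
    simp [Nat.lt_succ_of_le hk]
  rw [hp0, coeff_zero] at hcoeff
  exact mul_ne_zero hak (Complex.ofReal_ne_zero.2 hbk) hcoeff.symm

lemma tendstoLocallyUniformlyOn_weightedSum_nhds (b : ℕ → ℝ) (n : ℕ) (a : ℕ → ℂ) :
    TendstoLocallyUniformlyOn (weightedSum b n) (weightedSum b n a) (𝓝 a) Set.univ := by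
  rw [Metric.tendstoLocallyUniformlyOn_iff]
  intro ε hε x _
  let M := ‖x‖ + 1
  have hcont : Continuous fun a' : ℕ → ℂ =>
      ∑ k ∈ Finset.range (n + 1), ‖a k - a' k‖ * |b k| * M ^ k := by fun_prop
  have hlim := hcont.tendsto a
  simp only [sub_self, norm_zero, zero_mul, Finset.sum_const_zero] at hlim
  refine ⟨Metric.ball 0 M, mem_nhdsWithin_of_mem_nhds
    (Metric.isOpen_ball.mem_nhds (by simp [M])), ?_⟩
  filter_upwards [hlim.eventually_lt_const hε] with a' ha' y hy
  have hyM : ‖y‖ ≤ M := by simpa using (Metric.mem_ball.1 hy).le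
  refine lt_of_le_of_lt ?_ ha'
  rw [dist_eq_norm, weightedSum, weightedSum, ← Finset.sum_sub_distrib]
  refine (norm_sum_le _ _).trans (Finset.sum_le_sum fun k _ => ?_)
  rw [← sub_mul, ← sub_mul, norm_mul, norm_mul, norm_pow, Complex.norm_real, Real.norm_eq_abs]
  gcongr

/-- The configuration of zeros of a polynomial is a measurable function of its coefficients. -/
lemma measurable_zerosIn_weightedSum {U : Set ℂ} (hU : IsOpen U) {ψ : ℂ → ℂ}
    (hψ : AnalyticOnNhd ℂ ψ U) (hψ' : ∀ z ∈ U, deriv ψ z ≠ 0) {b : ℕ → ℝ} {n : ℕ}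
    (hb : ∀ k ≤ n, b k ≠ 0) :
    Measurable fun a : ℕ → ℂ => zerosIn U fun z => weightedSum b n a (ψ z) := by
  let s : Set (ℕ → ℂ) := {a | ∃ k ≤ n, a k ≠ 0}
  have hs : IsOpen s := by
    have : s = ⋃ k, ⋃ _ : k ≤ n, {a | a k ≠ 0} := by
      ext a
      simp [s]
    rw [this]
    exact isOpen_biUnion fun k _ => isOpen_ne_fun (continuous_apply k) continuous_const
  have hcont : ContinuousOn (fun a : ℕ → ℂ => zerosIn U fun z => weightedSum b n a (ψ z)) s := by
    intro a ha
    refine ContinuousAt.continuousWithinAt ?_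
    refine tendsto_zerosIn hU (Eventually.of_forall fun a' => analyticOnNhd_weightedSum_comp hψ b n a')
      (analyticOnNhd_weightedSum_comp hψ b n a)
      ((tendstoLocallyUniformlyOn_weightedSum_nhds b n a).comp ψ (Set.mapsTo_univ _ _)
        hψ.continuousOn) fun x hx => ?_
    obtain ⟨k, hk, hak⟩ := ha
    have := analyticOrderAt_comp_of_deriv_ne_zero (f := weightedSum b n a) (hψ x hx) (hψ' x hx)
    rw [Function.comp_def] at this
    rw [this]
    exact analyticOrderAt_weightedSum_ne_top ⟨k, hk, hak, hb k hk⟩ _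
  -- On the open set `s` Hurwitz gives continuity; off `s` the polynomial is identically zero and
  -- the configuration is constant.
  refine measurable_of_restrict_of_restrict_compl hs.measurableSet
    (continuousOn_iff_continuous_domRestrict.1 hcont).measurable ?_
  have hconst : sᶜ.domRestrict (fun a : ℕ → ℂ => zerosIn U fun z => weightedSum b n a (ψ z))
      = fun _ => zerosIn U fun _ => 0 := by
    ext1 ⟨a, ha⟩
    have hzero (k : ℕ) (hk : k ≤ n) : a k = 0 := by
      by_contra h
      exact ha ⟨k, hk, h⟩
    rw [Set.domRestrict_apply]
    congr 1
    ext z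
    exact Finset.sum_eq_zero fun k hk => by
      change a k * b k * ψ z ^ k = 0
      rw [hzero k (Nat.lt_succ_iff.1 (Finset.mem_range.1 hk)), zero_mul, zero_mul]
  rw [hconst]
  exact measurable_const

end PowerSeries

/-! ### Random coefficients and convergence in law of the zeros. -/

section RandomSeries

variable {Ω : Type*} [MeasurableSpace Ω] {μ : Measure Ω} {a : ℕ → Ω → ℂ}

/-- The involution of `ℕ` that reverses `{0, …, n}`. -/
def reverseUpTo (n k : ℕ) : ℕ := if k ≤ n then n - k else k

lemma reverseUpTo_injective (n : ℕ) : Function.Injective (reverseUpTo n) := by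
  intro i j h
  simp only [reverseUpTo] at h
  split_ifs at h <;> omega

/-- Both laws are the product of the same marginals, as the reindexing is injective. -/
lemma map_reverseUpTo (ha : IsCoefficientSequence μ a) (n : ℕ) :
    μ.map (fun ω k => a (reverseUpTo n k) ω) = μ.map (fun ω k => a k ω) := by
  rw [(ha.indep.precomp (reverseUpTo_injective n)).map_fun_eq_infinitePi_map
    (fun k => ha.measurable _), ha.indep.map_fun_eq_infinitePi_map ha.measurable]
  congr 1
  ext1 k
  rw [(ha.identDistrib (reverseUpTo n k)).map_eq, (ha.identDistrib k).map_eq]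

variable [IsProbabilityMeasure μ]

/-- Borel–Cantelli: integrability of `(m + 1) * log (1 + ‖a 0‖)` makes the probabilities that it
exceeds `k` summable. -/
lemma ae_eventually_norm_le_exp (ha : IsCoefficientSequence μ a) (m : ℕ) :
    ∀ᵐ ω ∂μ, ∀ᶠ k in atTop, ‖a k ω‖ ≤ Real.exp (k / (m + 1)) := by
  let X : Ω → ℝ := fun ω => (m + 1) * Real.log (1 + ‖a 0 ω‖)
  have hX : Integrable X μ := ha.integrable_log.const_mul _
  have hX0 : 0 ≤ X := fun ω =>
    mul_nonneg (by positivity) (Real.log_nonneg (by linarith [norm_nonneg (a 0 ω)]))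
  have hsum : ∑' k : ℕ, μ {ω | X ω ∈ Set.Ioi (k : ℝ)} < ⊤ :=
    letI : MeasureSpace Ω := ⟨μ⟩
    tsum_prob_mem_Ioi_lt_top hX hX0
  let t : ℕ → Set ℂ := fun k => {z | (k : ℝ) < (m + 1) * Real.log (1 + ‖z‖)}
  have ht (k : ℕ) : MeasurableSet (t k) :=
    measurableSet_lt measurable_const
      (measurable_const.mul (Real.measurable_log.comp (by fun_prop)))
  have heq (k : ℕ) : μ {ω | a k ω ∈ t k} = μ {ω | X ω ∈ Set.Ioi (k : ℝ)} :=
    (ha.identDistrib k).measure_mem_eq (ht k)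
  have hBC : ∀ᵐ ω ∂μ, ∀ᶠ k in atTop, ω ∉ {ω | a k ω ∈ t k} :=
    ae_eventually_notMem (by simpa only [heq] using hsum.ne)
  filter_upwards [hBC] with ω hω
  filter_upwards [hω] with k hk
  have hk' : (m + 1) * Real.log (1 + ‖a k ω‖) ≤ k := not_lt.1 hk
  have hpos : 0 < 1 + ‖a k ω‖ := by positivity
  have : Real.log (1 + ‖a k ω‖) ≤ k / (m + 1) := by
    rw [le_div_iff₀ (by positivity)]
    linarith
  have := (Real.log_le_iff_le_exp hpos).1 this
  linarith

lemma ae_isSubexponential (ha : IsCoefficientSequence μ a) :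
    ∀ᵐ ω ∂μ, IsSubexponential fun k => a k ω := by
  filter_upwards [ae_all_iff.2 fun m => ae_eventually_norm_le_exp ha m] with ω hω ρ hρ0 hρ
  have hlim : Tendsto (fun m : ℕ => Real.exp (1 / ((m : ℝ) + 1)) * ρ) atTop (𝓝 (1 * ρ)) := by
    refine Tendsto.mul_const ρ ?_
    simpa [Function.comp_def] using (Real.continuous_exp.tendsto 0).comp tendsto_one_div_add_atTop_nhds_zero_nat
  obtain ⟨m, hm⟩ := (hlim.eventually_lt_const (by simpa using hρ)).exists
  refine Summable.of_norm_bounded_eventually_nat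
    (summable_geometric_of_lt_one (by positivity) hm) ((hω m).mono fun k hk => ?_)
  rw [Real.norm_of_nonneg (by positivity), mul_pow, ← Real.exp_nat_mul, mul_one_div]
  gcongr

/-- The change of variable `ψ` covers both `z / R` and `R / z`; its nonvanishing derivative
preserves multiplicities. The limit is not identically zero because its value at `0` is `a 0 ≠ 0`.
-/
lemma tendstoInDistribution_zerosIn_weightedSum (ha : IsCoefficientSequence μ a)
    {b : ℕ → ℕ → ℝ} (hb0 : ∀ n j, j ≤ n → 0 < b n j) (hb1 : ∀ n j, j ≤ n → b n j ≤ 1)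
    (hb : ∀ j, Tendsto (fun n => b n j) atTop (𝓝 1)) {U : Set ℂ} (hU : IsOpen U) {ψ : ℂ → ℂ}
    (hψ : AnalyticOnNhd ℂ ψ U) (hψ' : ∀ z ∈ U, deriv ψ z ≠ 0) (hmaps : Set.MapsTo ψ U (disk 1)) :
    TendstoInDistribution
      (fun (n : ℕ) (ω : Ω) => zerosIn U fun z => weightedSum (b n) n (fun k => a k ω) (ψ z))
      atTop (fun ω => zerosIn U fun z => coeffSeries (fun k => a k ω) (ψ z)) (fun _ => μ) μ := by
  have : LocallyCompactSpace U := hU.locallyCompactSpace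
  have hmeas (n : ℕ) : AEMeasurable
      (fun ω => zerosIn U fun z => weightedSum (b n) n (fun k => a k ω) (ψ z)) μ :=
    ((measurable_zerosIn_weightedSum hU hψ hψ' fun k hk => (hb0 n k hk).ne').comp
      (measurable_pi_iff.2 ha.measurable)).aemeasurable
  have hlim : ∀ᵐ ω ∂μ, Tendsto
      (fun n => zerosIn U fun z => weightedSum (b n) n (fun k => a k ω) (ψ z)) atTop
      (𝓝 (zerosIn U fun z => coeffSeries (fun k => a k ω) (ψ z))) := by
    filter_upwards [ae_isSubexponential ha, ha.ae_ne_zero] with ω hω hω0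
    refine tendsto_zerosIn hU
      (Eventually.of_forall fun n => analyticOnNhd_weightedSum_comp hψ (b n) n _)
      (fun x hx => (hω.analyticOnNhd _ (hmaps hx)).comp (hψ x hx))
      ((tendstoLocallyUniformlyOn_weightedSum hω (fun n j hj => (hb0 n j hj).le) hb1 hb).comp ψ
        hmaps hψ.continuousOn) fun x hx => ?_
    have := analyticOrderAt_comp_of_deriv_ne_zero (f := coeffSeries fun k => a k ω) (hψ x hx)
      (hψ' x hx)
    rw [Function.comp_def] at this
    rw [this]
    exact hω.analyticOrderAt_ne_top hω0 (hmaps hx)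
  exact tendstoInDistribution_of_ae_tendsto hmeas
    (aemeasurable_of_tendsto_metrizable_ae atTop hmeas hlim) hlim

/-- The reversal changes with `n`, so the almost sure argument does not carry over; but each
reversed configuration has the law of the unreversed one, and only laws matter. -/
lemma tendstoInDistribution_zerosIn_weightedSum_reverse (ha : IsCoefficientSequence μ a)
    {b : ℕ → ℕ → ℝ} (hb0 : ∀ n j, j ≤ n → 0 < b n j) (hb1 : ∀ n j, j ≤ n → b n j ≤ 1)
    (hb : ∀ j, Tendsto (fun n => b n j) atTop (𝓝 1)) {U : Set ℂ} (hU : IsOpen U) {ψ : ℂ → ℂ}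
    (hψ : AnalyticOnNhd ℂ ψ U) (hψ' : ∀ z ∈ U, deriv ψ z ≠ 0) (hmaps : Set.MapsTo ψ U (disk 1)) :
    TendstoInDistribution
      (fun (n : ℕ) (ω : Ω) =>
        zerosIn U fun z => weightedSum (b n) n (fun k => a (reverseUpTo n k) ω) (ψ z))
      atTop (fun ω => zerosIn U fun z => coeffSeries (fun k => a k ω) (ψ z)) (fun _ => μ) μ := by
  have h := tendstoInDistribution_zerosIn_weightedSum ha hb0 hb1 hb hU hψ hψ' hmaps
  have hmeas (n : ℕ) := measurable_zerosIn_weightedSum hU hψ hψ'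
    (b := b n) (n := n) fun k hk => (hb0 n k hk).ne'
  have hrev (n : ℕ) : Measurable fun ω k => a (reverseUpTo n k) ω :=
    measurable_pi_iff.2 fun k => ha.measurable _
  refine ⟨fun n => ((hmeas n).comp (hrev n)).aemeasurable, h.aemeasurable_limit, ?_⟩
  refine h.tendsto.congr fun n => Subtype.ext ?_
  change μ.map ((fun a' : ℕ → ℂ => zerosIn U fun z => weightedSum (b n) n a' (ψ z)) ∘
      fun ω k => a k ω) = μ.map ((fun a' : ℕ → ℂ => zerosIn U fun z => weightedSum (b n) n a' (ψ z))
      ∘ fun ω k => a (reverseUpTo n k) ω)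
  rw [← Measure.map_map (hmeas n) (hrev n),
    ← Measure.map_map (hmeas n) (measurable_pi_iff.2 ha.measurable), map_reverseUpTo ha n]

end RandomSeries

/-! ### What being a component says about the mass near the circle of radius `R`. -/

section Component

variable {ν : Measure ℂ} {U : Set ℂ}

lemma IsComponentOf.measure_eq_zero (h : IsComponentOf U ν.supportᶜ) : ν U = 0 := by
  obtain ⟨x, -, rfl⟩ := h
  exact measure_mono_null (connectedComponentIn_subset _ _) Measure.support_mem_ae

lemma IsComponentOf.subset_of_measure_eq_zero (h : IsComponentOf U ν.supportᶜ) {V : Set ℂ}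
    (hV : IsOpen V) (hVc : IsPreconnected V) (hUV : U ⊆ V) (h0 : ν V = 0) : V ⊆ U := by
  obtain ⟨x, hx, rfl⟩ := h
  exact hVc.subset_connectedComponentIn (hUV (mem_connectedComponentIn hx))
    (Measure.subset_compl_support_of_isOpen hV h0)

lemma isPreconnected_disk (r : ℝ) : IsPreconnected (disk r) := by
  rw [disk_eq_ball]
  exact (convex_ball 0 r).isPreconnected

lemma isPreconnected_exteriorDisk {r : ℝ} (hr : 0 ≤ r) : IsPreconnected (exteriorDisk r) := by
  have himage : (fun p : ℝ × ℝ => (p.1 : ℂ) * Complex.exp (p.2 * Complex.I)) ''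
      (Set.Ioi r ×ˢ Set.univ) = exteriorDisk r := by
    ext z
    constructor
    · rintro ⟨⟨t, θ⟩, ⟨ht, -⟩, rfl⟩
      have ht' : r < t := ht
      simpa [exteriorDisk, Complex.norm_exp_ofReal_mul_I, abs_of_pos (hr.trans_lt ht')] using ht'
    · exact fun hz => ⟨(‖z‖, z.arg), ⟨hz, trivial⟩, Complex.norm_mul_exp_arg_mul_I z⟩
  rw [← himage]
  exact (isPreconnected_Ioi.prod isPreconnected_univ).image _ (by fun_prop)

variable {R : ℝ}

lemma ae_log_norm_ge_of_disk (hR : 0 < R)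
    (h : IsComponentOf (disk R) ν.supportᶜ) : ∀ᵐ z ∂ν, 0 ≤ Real.log ‖z‖ - Real.log R := by
  filter_upwards [measure_eq_zero_iff_ae_notMem.1 h.measure_eq_zero] with z hz
  exact sub_nonneg.2 (Real.log_le_log hR (not_lt.1 hz))

/-- Otherwise a strictly larger disk would be null, hence contained in the component, which does not
contain the point `R`. -/
lemma measure_log_norm_lt_pos_of_disk (hν : IsBackground ν) (hR : 0 < R)
    (h : IsComponentOf (disk R) ν.supportᶜ) {ε : ℝ} (hε : 0 < ε) :
    0 < ν {z | Real.log ‖z‖ - Real.log R < ε} := by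
  rw [pos_iff_ne_zero]
  intro h0
  have hlt : R < R * Real.exp ε := lt_mul_of_one_lt_right hR (Real.one_lt_exp_iff.2 hε)
  have hnull : ν (disk (R * Real.exp ε)) = 0 := by
    -- The origin is treated apart: with `Real.log 0 = 0` it may lie outside the sublevel set.
    refine measure_mono_null (t := {0} ∪ {z | Real.log ‖z‖ - Real.log R < ε}) (fun z hz => ?_)
      (measure_union_null hν.zero_not_atom h0)
    by_cases hz0 : z = 0
    · exact Or.inl hz0
    · refine Or.inr ?_
      have := Real.log_lt_log (norm_pos_iff.2 hz0) hz
      rw [Real.log_mul hR.ne' (Real.exp_pos ε).ne', Real.log_exp] at this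
      change Real.log ‖z‖ - Real.log R < ε
      linarith
  have hsub := h.subset_of_measure_eq_zero (isOpen_disk _) (isPreconnected_disk _)
    (fun z hz => lt_trans hz hlt) hnull
  have hmem : (R : ℂ) ∈ disk (R * Real.exp ε) := by
    change ‖(R : ℂ)‖ < R * Real.exp ε
    rwa [Complex.norm_real, Real.norm_of_nonneg hR.le]
  have := hsub hmem
  simp [disk, abs_of_pos hR] at this

lemma ae_log_norm_le_of_exteriorDisk (hν : IsBackground ν)
    (h : IsComponentOf (exteriorDisk R) ν.supportᶜ) :
    ∀ᵐ z ∂ν, 0 ≤ Real.log R - Real.log ‖z‖ := by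
  filter_upwards [measure_eq_zero_iff_ae_notMem.1 h.measure_eq_zero,
    ae_ne_zero_of_isBackground hν] with z hz hz0
  exact sub_nonneg.2 (Real.log_le_log (norm_pos_iff.2 hz0) (not_lt.1 hz))

lemma measure_log_norm_gt_pos_of_exteriorDisk (hR : 0 < R)
    (h : IsComponentOf (exteriorDisk R) ν.supportᶜ) {ε : ℝ} (hε : 0 < ε) :
    0 < ν {z | Real.log R - Real.log ‖z‖ < ε} := by
  rw [pos_iff_ne_zero]
  intro h0
  have hpos : 0 < R * Real.exp (-ε) := by positivity
  have hlt : R * Real.exp (-ε) < R :=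
    mul_lt_of_lt_one_right hR (Real.exp_lt_one_iff.2 (neg_lt_zero.2 hε))
  have hnull : ν (exteriorDisk (R * Real.exp (-ε))) = 0 := by
    refine measure_mono_null (fun z hz => ?_) h0
    have := Real.log_lt_log hpos hz
    rw [Real.log_mul hR.ne' (Real.exp_pos _).ne', Real.log_exp] at this
    change Real.log R - Real.log ‖z‖ < ε
    linarith
  have hsub := h.subset_of_measure_eq_zero (isOpen_exteriorDisk _)
    (isPreconnected_exteriorDisk hpos.le) (fun z hz => lt_trans hlt hz) hnull
  have hmem : (R : ℂ) ∈ exteriorDisk (R * Real.exp (-ε)) := by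
    change R * Real.exp (-ε) < ‖(R : ℂ)‖
    simpa [abs_of_pos hR] using hlt
  have := hsub hmem
  simp [exteriorDisk, abs_of_pos hR] at this

end Component

/-! ### Monomial norms as penalized moments. -/

section MonomialNorm

variable {ν : Measure ℂ} [IsProbabilityMeasure ν]

lemma posLog_inv_mul_norm {z w : ℂ} (hz : z ≠ 0) (hw : w ≠ 0) :
    Real.posLog (‖z‖⁻¹ * ‖w‖) = max 0 (Real.log ‖w‖ - Real.log ‖z‖) := by
  rw [Real.posLog_apply, Real.log_mul (inv_ne_zero (norm_ne_zero_iff.2 hz))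
    (norm_ne_zero_iff.2 hw), Real.log_inv, neg_add_eq_sub]

/-- The logarithmic distance to the circle of radius `R`, counted positively outside. -/
noncomputable def logOutward (R : ℝ) (z : ℂ) : ℝ := Real.log ‖z‖ - Real.log R

/-- The logarithmic distance to the circle of radius `R`, counted positively inside. -/
noncomputable def logInward (R : ℝ) (z : ℂ) : ℝ := Real.log R - Real.log ‖z‖

lemma measurable_logOutward (R : ℝ) : Measurable (logOutward R) :=
  (Real.measurable_log.comp measurable_norm).sub_const _

lemma measurable_logInward (R : ℝ) : Measurable (logInward R) :=
  (Real.measurable_log.comp measurable_norm).const_sub _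

lemma integrable_logOutward (hν : IsBackground ν) (R : ℝ) : Integrable (logOutward R) ν :=
  hν.integrable_log.sub (integrable_const _)

lemma integrable_logInward (hν : IsBackground ν) (R : ℝ) : Integrable (logInward R) ν :=
  (integrable_const _).sub hν.integrable_log

/-- Integrate $\max(\log|z|,\log|w|)=\log|w|+(\log|z|-\log|w|)^+$ in $w$; the inward version takes
out $\log|z|$ instead. -/
lemma logPotential_eq_add_meanExcess_logOutward (hν : IsBackground ν) (R : ℝ) {z : ℂ}
    (hz : z ≠ 0) :
    logPotential ν z = (∫ w, Real.log ‖w‖ ∂ν) + meanExcess ν (logOutward R) z := by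
  rw [logPotential_eq_integral_posLog hν hz, meanExcess,
    ← integral_add hν.integrable_log (integrable_max_sub (integrable_logOutward hν R) z)]
  refine integral_congr_ae ((ae_ne_zero_of_isBackground hν).mono fun w hw => ?_)
  simp only [posLog_inv_mul_norm hz hw, logOutward, sub_sub_sub_cancel_right]
  grind

lemma logPotential_eq_add_meanExcess_logInward (hν : IsBackground ν) (R : ℝ) {z : ℂ}
    (hz : z ≠ 0) :
    logPotential ν z = Real.log ‖z‖ + meanExcess ν (logInward R) z := by
  have hconst : Real.log ‖z‖ = ∫ _, Real.log ‖z‖ ∂ν := by simp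
  rw [logPotential_eq_integral_posLog hν hz, meanExcess]
  nth_rw 2 [hconst]
  rw [← integral_add (integrable_const _) (integrable_max_sub (integrable_logInward hν R) z)]
  refine integral_congr_ae ((ae_ne_zero_of_isBackground hν).mono fun w hw => ?_)
  simp only [posLog_inv_mul_norm hz hw, logInward, sub_sub_sub_cancel_left, max_comm]

lemma sqrt_integral_sq_mul {X : Type*} [MeasurableSpace X] (ρ : Measure X) {c : ℝ} (hc : 0 ≤ c)
    (f : X → ℝ) : Real.sqrt (∫ x, c ^ 2 * f x ∂ρ) = c * Real.sqrt (∫ x, f x ∂ρ) := by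
  rw [integral_const_mul, Real.sqrt_mul (sq_nonneg c), Real.sqrt_sq hc]

lemma norm_pow_sq_eq_exp {z : ℂ} (hz : z ≠ 0) (k : ℕ) :
    ‖z ^ k‖ ^ 2 = Real.exp (2 * k * Real.log ‖z‖) := by
  rw [norm_pow, ← pow_mul, mul_comm k 2, ← Real.exp_log (norm_pos_iff.2 hz), ← Real.exp_nat_mul,
    Real.log_exp]
  push_cast
  rfl

lemma monomialNorm_eq_of_logOutward (hν : IsBackground ν) {R : ℝ} (hR : 0 < R) (n k : ℕ) :
    monomialNorm ν n k = R ^ k * Real.exp (-(n * ∫ w, Real.log ‖w‖ ∂ν))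
      * Real.sqrt (penalizedMoment ν (logOutward R) n k) := by
  rw [monomialNorm, penalizedMoment, ← sqrt_integral_sq_mul ν (by positivity)]
  congr 1
  refine integral_congr_ae ((ae_ne_zero_of_isBackground hν).mono fun z hz => ?_)
  simp only
  have hRk : R ^ k = Real.exp (k * Real.log R) := by rw [Real.exp_nat_mul, Real.exp_log hR]
  rw [norm_pow_sq_eq_exp hz, logPotential_eq_add_meanExcess_logOutward hν R hz, hRk,
    ← Real.exp_add, ← Real.exp_add, ← Real.exp_nat_mul, ← Real.exp_add, logOutward]
  congr 1
  push_cast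
  ring

/-- The term $\log|z|$ of the potential, multiplied by $-2n$, cancels $|z|^{2n}$, so exponents are
naturally counted down from `n`. -/
lemma monomialNorm_sub_eq_of_logInward (hν : IsBackground ν) {R : ℝ} (hR : 0 < R) {n j : ℕ}
    (hj : j ≤ n) :
    monomialNorm ν n (n - j) = (R ^ j)⁻¹ * Real.sqrt (penalizedMoment ν (logInward R) n j) := by
  rw [monomialNorm, penalizedMoment, ← sqrt_integral_sq_mul ν (by positivity)]
  congr 1
  refine integral_congr_ae ((ae_ne_zero_of_isBackground hν).mono fun z hz => ?_)
  simp only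
  have hRj : (R ^ j)⁻¹ = Real.exp (-(j * Real.log R)) := by
    rw [Real.exp_neg, Real.exp_nat_mul, Real.exp_log hR]
  rw [norm_pow_sq_eq_exp hz, logPotential_eq_add_meanExcess_logInward hν R hz, hRj,
    ← Real.exp_add, ← Real.exp_nat_mul, ← Real.exp_add, logInward, Nat.cast_sub hj]
  congr 1
  push_cast
  ring

end MonomialNorm

/-! ### Normalized weights: positive, at most one, tending to one. -/

section Ratio

variable {X : Type*} [MeasurableSpace X] {ν : Measure X} [IsProbabilityMeasure ν] {s : X → ℝ}

/-- The normalized inverse of the penalized `L²` norm. -/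
noncomputable def momentRatio (ν : Measure X) (s : X → ℝ) (n j : ℕ) : ℝ :=
  Real.sqrt (penalizedMoment ν s n 0) / Real.sqrt (penalizedMoment ν s n j)

lemma momentRatio_pos (hs : Measurable s) (hi : Integrable s ν) {n j : ℕ} (hj : j ≤ n) :
    0 < momentRatio ν s n j :=
  div_pos (Real.sqrt_pos.2 (penalizedMoment_zero_pos hs hi n))
    (Real.sqrt_pos.2 (penalizedMoment_pos hs hi hj))

lemma momentRatio_le_one (hs : Measurable s) (hi : Integrable s ν) (h0 : ∀ᵐ y ∂ν, 0 ≤ s y)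
    {n j : ℕ} (hj : j ≤ n) : momentRatio ν s n j ≤ 1 :=
  (div_le_one (Real.sqrt_pos.2 (penalizedMoment_pos hs hi hj))).2
    (Real.sqrt_le_sqrt (penalizedMoment_zero_le hs hi h0 hj))

lemma tendsto_momentRatio (hs : Measurable s) (hi : Integrable s ν) (h0 : ∀ᵐ y ∂ν, 0 ≤ s y)
    (hpos : ∀ ε > 0, 0 < ν {y | s y < ε}) (j : ℕ) :
    Tendsto (fun n => momentRatio ν s n j) atTop (𝓝 1) := by
  have h := ((Real.continuous_sqrt.tendsto 1).comp
    (tendsto_penalizedMoment_div hs hi h0 hpos j)).inv₀ (by simp)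
  simp only [Function.comp_def, Real.sqrt_one, inv_one] at h
  refine h.congr fun n => ?_
  rw [Real.sqrt_div' _ (penalizedMoment_zero_pos hs hi n).le, inv_div, momentRatio]

end Ratio

/-! ### The random polynomial as a nonvanishing factor times a weighted sum. -/

section WeightedPoly

variable {ν : Measure ℂ} [IsProbabilityMeasure ν] {R : ℝ}

lemma weightedPoly_eq_of_logOutward (hν : IsBackground ν) (hR : 0 < R) (n : ℕ) (a : ℕ → ℂ)
    (z : ℂ) :
    weightedPoly ν n a z = ((Real.exp (-(n * ∫ w, Real.log ‖w‖ ∂ν))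
        * Real.sqrt (penalizedMoment ν (logOutward R) n 0) : ℝ) : ℂ)⁻¹
      * weightedSum (momentRatio ν (logOutward R) n) n a (z / R) := by
  rw [weightedPoly, weightedSum, Finset.mul_sum]
  refine Finset.sum_congr rfl fun k hk => ?_
  have hRC : (R : ℂ) ≠ 0 := Complex.ofReal_ne_zero.2 hR.ne'
  have hsqrt {j : ℕ} (hj : j ≤ n) :
      (Real.sqrt (penalizedMoment ν (logOutward R) n j) : ℂ) ≠ 0 :=
    Complex.ofReal_ne_zero.2 (Real.sqrt_pos.2 (penalizedMoment_pos (measurable_logOutward R)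
      (integrable_logOutward hν R) hj)).ne'
  have h0 := hsqrt (Nat.zero_le n)
  have hk := hsqrt (Nat.lt_succ_iff.1 (Finset.mem_range.1 hk))
  rw [monomialNorm_eq_of_logOutward hν hR, momentRatio]
  generalize (n : ℝ) * ∫ w, Real.log ‖w‖ ∂ν = v
  push_cast
  have := Complex.exp_ne_zero (-(v : ℂ))
  rw [div_pow]
  field_simp

lemma weightedPoly_eq_of_logInward (hν : IsBackground ν) (hR : 0 < R) (n : ℕ) (a : ℕ → ℂ)
    {z : ℂ} (hz : z ≠ 0) :
    weightedPoly ν n a z = z ^ n * (Real.sqrt (penalizedMoment ν (logInward R) n 0) : ℂ)⁻¹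
      * weightedSum (momentRatio ν (logInward R) n) n (fun k => a (reverseUpTo n k)) (R / z) := by
  rw [weightedPoly, weightedSum, Finset.mul_sum, ← Finset.sum_flip]
  refine Finset.sum_congr rfl fun j hj => ?_
  have hjn := Nat.lt_succ_iff.1 (Finset.mem_range.1 hj)
  have hRC : (R : ℂ) ≠ 0 := Complex.ofReal_ne_zero.2 hR.ne'
  have hsqrt {j : ℕ} (hj : j ≤ n) :
      (Real.sqrt (penalizedMoment ν (logInward R) n j) : ℂ) ≠ 0 :=
    Complex.ofReal_ne_zero.2 (Real.sqrt_pos.2 (penalizedMoment_pos (measurable_logInward R)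
      (integrable_logInward hν R) hj)).ne'
  have h0 := hsqrt (Nat.zero_le n)
  have hj := hsqrt hjn
  rw [monomialNorm_sub_eq_of_logInward hν hR hjn, momentRatio, reverseUpTo, if_pos hjn]
  obtain ⟨m, rfl⟩ := Nat.exists_eq_add_of_le hjn
  rw [Nat.add_sub_cancel_left]
  push_cast
  rw [div_pow, pow_add]
  field_simp

end WeightedPoly

/-! ### Zeros under nonvanishing factors and dilations. -/

section Zeros

lemma zerosIn_eq_of_eqOn_mul {U : Set ℂ} (hU : IsOpen U) {f g h : ℂ → ℂ}
    (hg : AnalyticOnNhd ℂ g U) (hh : AnalyticOnNhd ℂ h U) (hne : ∀ z ∈ U, h z ≠ 0)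
    (heq : Set.EqOn f (fun z => h z * g z) U) : zerosIn U f = zerosIn U g := by
  have hf : AnalyticOnNhd ℂ f U := (hh.mul hg).congr hU heq.symm
  ext x
  rw [zerosIn_mult hf, zerosIn_mult hg, analyticOrderNatAt, analyticOrderNatAt,
    analyticOrderAt_congr (heq.eventuallyEq_of_mem (hU.mem_nhds x.2)),
    show (fun z => h z * g z) = h * g from rfl, analyticOrderAt_mul (hh x x.2) (hg x x.2),
    (hh x x.2).analyticOrderAt_eq_zero.2 (hne x x.2), zero_add]

lemma map_zerosIn_dilation {U V : Set ℂ} (e : U ≃ₜ V) {c : ℂ} (hc : c ≠ 0)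
    (he : ∀ x, (e x : ℂ) = c * x) {f : ℂ → ℂ} (hf : AnalyticOnNhd ℂ f U) :
    (zerosIn U f).map e = zerosIn V fun z => f (z / c) := by
  have hdiv : AnalyticOnNhd ℂ (fun z : ℂ => z / c) V := fun z _ => by fun_prop
  have hf' : AnalyticOnNhd ℂ (fun z => f (z / c)) V := by
    intro y hy
    obtain ⟨x, hx⟩ := e.surjective ⟨y, hy⟩
    have hxy : y / c = x := by
      rw [show y = e x from (congrArg Subtype.val hx).symm, he, mul_div_cancel_left₀ _ hc]
    exact AnalyticAt.comp (g := f) (by rw [hxy]; exact hf x x.2) (hdiv y hy)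
  ext y
  obtain ⟨x, rfl⟩ := e.surjective y
  rw [zerosIn_mult hf']
  change (zerosIn U f).mult (e.symm (e x)) = _
  rw [e.symm_apply_apply, zerosIn_mult hf, analyticOrderNatAt, analyticOrderNatAt]
  have hderiv : deriv (fun z : ℂ => z / c) (e x) ≠ 0 := by simp [hc]
  have h := analyticOrderAt_comp_of_deriv_ne_zero (f := f) (hdiv _ (e x).2) hderiv
  rw [Function.comp_def] at h
  rw [h, he, mul_div_cancel_left₀ _ hc]

lemma analyticOnNhd_const_div_exteriorDisk (c : ℂ) {r : ℝ} (hr : 0 ≤ r) :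
    AnalyticOnNhd ℂ (fun z : ℂ => c / z) (exteriorDisk r) := fun z hz => by
  have : z ≠ 0 := norm_pos_iff.1 (hr.trans_lt hz)
  fun_prop (disch := assumption)

variable {ν : Measure ℂ} [IsProbabilityMeasure ν] {R : ℝ}

lemma zerosIn_weightedPoly_of_logOutward (hν : IsBackground ν) (hR : 0 < R) (n : ℕ) (a : ℕ → ℂ) :
    zerosIn (disk R) (weightedPoly ν n a)
      = zerosIn (disk R) fun z => weightedSum (momentRatio ν (logOutward R) n) n a (z / R) := by
  have hψ : AnalyticOnNhd ℂ (fun z : ℂ => z / R) (disk R) := fun z _ => by fun_prop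
  refine zerosIn_eq_of_eqOn_mul (isOpen_disk R) (analyticOnNhd_weightedSum_comp hψ _ n a)
    (analyticOnNhd_const (v := ((Real.exp (-(n * ∫ w, Real.log ‖w‖ ∂ν))
      * Real.sqrt (penalizedMoment ν (logOutward R) n 0) : ℝ) : ℂ)⁻¹)) (fun _ _ => ?_)
    fun z _ => weightedPoly_eq_of_logOutward hν hR n a z
  exact inv_ne_zero (Complex.ofReal_ne_zero.2 (mul_pos (Real.exp_pos _) (Real.sqrt_pos.2
    (penalizedMoment_zero_pos (measurable_logOutward R) (integrable_logOutward hν R) n))).ne')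

lemma zerosIn_weightedPoly_of_logInward (hν : IsBackground ν) (hR : 0 < R) (n : ℕ) (a : ℕ → ℂ) :
    zerosIn (exteriorDisk R) (weightedPoly ν n a)
      = zerosIn (exteriorDisk R) fun z =>
        weightedSum (momentRatio ν (logInward R) n) n (fun k => a (reverseUpTo n k)) (R / z) := by
  have hne (z : ℂ) (hz : z ∈ exteriorDisk R) : z ≠ 0 := norm_pos_iff.1 (hR.trans hz)
  refine zerosIn_eq_of_eqOn_mul (isOpen_exteriorDisk R)
    (analyticOnNhd_weightedSum_comp (analyticOnNhd_const_div_exteriorDisk (R : ℂ) hR.le) _ n _)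
    (h := fun z => z ^ n * (Real.sqrt (penalizedMoment ν (logInward R) n 0) : ℂ)⁻¹)
    (fun z _ => by fun_prop) (fun z hz => ?_)
    fun z hz => weightedPoly_eq_of_logInward hν hR n a (hne z hz)
  exact mul_ne_zero (pow_ne_zero _ (hne z hz)) (inv_ne_zero (Complex.ofReal_ne_zero.2
    (Real.sqrt_pos.2 (penalizedMoment_zero_pos (measurable_logInward R)
      (integrable_logInward hν R) n)).ne'))

end Zeros

/-! ### The two cases assembled. -/

theorem theorem3 {Ω : Type*} [MeasurableSpace Ω] (μ : Measure Ω) [IsProbabilityMeasure μ]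
    (a : ℕ → Ω → ℂ) (ha : IsCoefficientSequence μ a)
    (ν : Measure ℂ) [IsProbabilityMeasure ν] (hν : IsBackground ν)
    (R : ℝ) (hR : 0 < R) :
    (IsComponentOf (disk R) ν.supportᶜ →
      (∀ᵐ ω ∂μ, ∀ z ∈ disk 1, Summable fun k : ℕ => a k ω * z ^ k) ∧
      TendstoInDistribution
        (fun (n : ℕ) (ω : Ω) => zerosIn (disk R) (weightedPoly ν n fun k => a k ω))
        atTop
        (fun ω : Ω => (zerosIn (disk 1) (coeffSeries fun k => a k ω)).map (diskDilation hR))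
        (fun _ => μ) μ) ∧
    (IsComponentOf (exteriorDisk R) ν.supportᶜ →
      (∀ᵐ ω ∂μ, ∀ z ∈ exteriorDisk 1, Summable fun k : ℕ => a k ω * (1 / z) ^ k) ∧
      TendstoInDistribution
        (fun (n : ℕ) (ω : Ω) => zerosIn (exteriorDisk R) (weightedPoly ν n fun k => a k ω))
        atTop
        (fun ω : Ω => (zerosIn (exteriorDisk 1) fun z => coeffSeries (fun k => a k ω) (1 / z)).map
          (exteriorDilation hR))
        (fun _ => μ) μ) := by
  have hRC : (R : ℂ) ≠ 0 := Complex.ofReal_ne_zero.2 hR.ne'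
  have hinv {z : ℂ} (hz : z ∈ exteriorDisk 1) : 1 / z ∈ disk 1 := by
    change ‖1 / z‖ < 1
    rw [norm_div, norm_one]
    exact (div_lt_one (zero_lt_one.trans hz)).2 hz
  have hne {r : ℝ} (hr : 0 ≤ r) {z : ℂ} (hz : z ∈ exteriorDisk r) : z ≠ 0 :=
    norm_pos_iff.1 (hr.trans_lt hz)
  refine ⟨fun hcomp => ⟨(ae_isSubexponential ha).mono fun ω hω z hz => hω.summable hz, ?_⟩,
    fun hcomp => ⟨(ae_isSubexponential ha).mono fun ω hω z hz => hω.summable (hinv hz), ?_⟩⟩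
  · have hs := measurable_logOutward R
    have hi := integrable_logOutward hν R
    have h0 : ∀ᵐ z ∂ν, 0 ≤ logOutward R z := ae_log_norm_ge_of_disk hR hcomp
    have hψ : AnalyticOnNhd ℂ (fun z : ℂ => z / R) (disk R) := fun z _ => by fun_prop
    refine (tendstoInDistribution_zerosIn_weightedSum ha
      (fun n j hj => momentRatio_pos hs hi hj) (fun n j hj => momentRatio_le_one hs hi h0 hj)
      (tendsto_momentRatio hs hi h0 fun ε hε => measure_log_norm_lt_pos_of_disk hν hR hcomp hε)
      (isOpen_disk R) hψ (fun z _ => by simp [hRC]) fun z hz => ?_).congr (fun n => ?_) ?_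
    · change ‖z / R‖ < 1
      rw [norm_div, Complex.norm_real, Real.norm_of_nonneg hR.le]
      exact (div_lt_one hR).2 hz
    · exact Eventually.of_forall fun ω => (zerosIn_weightedPoly_of_logOutward hν hR n _).symm
    · filter_upwards [ae_isSubexponential ha] with ω hω
      exact (map_zerosIn_dilation (diskDilation hR) hRC (fun _ => rfl)
        hω.analyticOnNhd).symm
  · have hs := measurable_logInward R
    have hi := integrable_logInward hν R
    have h0 : ∀ᵐ z ∂ν, 0 ≤ logInward R z := ae_log_norm_le_of_exteriorDisk hν hcomp
    have hψ := analyticOnNhd_const_div_exteriorDisk (R : ℂ) hR.le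
    refine (tendstoInDistribution_zerosIn_weightedSum_reverse ha
      (fun n j hj => momentRatio_pos hs hi hj) (fun n j hj => momentRatio_le_one hs hi h0 hj)
      (tendsto_momentRatio hs hi h0 fun ε hε =>
        measure_log_norm_gt_pos_of_exteriorDisk hR hcomp hε)
      (isOpen_exteriorDisk R) hψ (fun z hz => ?_) fun z hz => ?_).congr (fun n => ?_) ?_
    · simp [div_eq_mul_inv, hRC, hne hR.le hz]
    · change ‖R / z‖ < 1
      rw [norm_div, Complex.norm_real, Real.norm_of_nonneg hR.le]
      exact (div_lt_one (hR.trans hz)).2 hz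
    · exact Eventually.of_forall fun ω =>
        (zerosIn_weightedPoly_of_logInward hν hR n fun k => a k ω).symm
    · filter_upwards [ae_isSubexponential ha] with ω hω
      have han : AnalyticOnNhd ℂ (fun z => coeffSeries (fun k => a k ω) (1 / z))
          (exteriorDisk 1) := fun z hz => by
        exact (hω.analyticOnNhd (1 / z) (hinv hz)).fun_comp
          (analyticOnNhd_const_div_exteriorDisk 1 zero_le_one z hz)
      have h := map_zerosIn_dilation (exteriorDilation hR) hRC
        (fun _ => rfl) han
      -- Dilating `1 / z` gives `1 / (z / R)`, which is the variable `R / z` of the weighted sums.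
      simp only [one_div_div] at h
      exact h.symm
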